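/- **Setting.** Let $\Omega_{\rm loc}\subseteq\mathbb R^d$ be closed, $A\subseteq\mathbb R^m$ nonempty and compact, $p\in\{0,1\}$, $\Omega=\Omega_{\rm loc}^{\mathbb N_0}$ with the product $\sigma$-field and canonical process $(X_t)_{t\in\mathbb N_0}$. Let $\mathcal M_1(\Omega_{\rm loc})$ be the set of Borel probability measures on $\Omega_{\rm loc}$. Let $C_p=C_p(\Omega_{\rm loc},\mathbb R)$ be the set of continuous $g:\Omega_{\rm loc}\to\mathbb R$ with $\|g\|_{C_p}:=\sup_{x}\frac{|g(x)|}{1+\|x\|^p}<\infty$. Let $\tau_p$ be the topology on the probability measures with finite $p$-th moment in which $\mu_n\to\mu$ iff $\int g\,d\mu_n\to\int g\,d\mu$ for all $g\in C_p$ (the coarsest topology making all maps $\mu\mapsto\int g\,d\mu$, $g\in C_p$, continuous). Let $(x,a)\mapsto\mathcal P(x,a)\subseteq\mathcal M_1(\Omega_{\rm loc})$, $(x,a)\in\Omega_{\rm loc}\times A$, be a set-valued map with nonempty $\tau_p$-compact values that is upper and lower hemicontinuous with respect to $\tau_p$, and let $C_P\ge1$ be such that $\int(1+\|y\|^p)\,\mathbb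 P(dy)\le C_P(1+\|x\|^p)$ for all $(x,a)$ and $\mathbb P\in\mathcal P(x,a)$ (in particular, these $\mathbb P$ have finite $p$-th moment). Let $r:\Omega_{\rm loc}\times A\times\Omega_{\rm loc}\to\mathbb R$ be continuous such that, for some $L>0$, $C_r\ge1$ and some $\rho_0,\rho_A:[0,\infty]\to[0,\infty]$ with $\rho(0)=0=\lim_{s\to0}\rho(s)$ for $\rho\in\{\rho_0,\rho_A\}$, $$|r(x_0,a,x_1)-r(x_0',a',x_1)|\le L(1+\|x_1\|^p)\big(\rho_0(\|x_0-x_0'\|)+\rho_A(\|a-a'\|)\big),\qquad |r(x_0,a,x_1)|\le C_r(1+\|x_0\|^p+\|x_1\|^p)$$ for all $x_0,x_0',x_1\in\Omega_{\rm loc}$, $a,a'\in A$. Let $0<\alpha<1/C_P$. Let $\mathcal A_{\rm loc}$ be the set of measurable maps $\Omega_{\rm loc}\to A$ and $\mathcal A$ the set of sequences $\mathbf a=(a_t(X_t))_{t\in\mathbb N_0}$ with $a_t\in\mathcal A_{\rm loc}$. For $a_{\rm loc}\in\mathcal A_{\rm loc}$ let $\mathbf P_{a_{\rm loc}}$ be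 the set of measurable $\mathbb P_0:\Omega_{\rm loc}\to\mathcal M_1(\Omega_{\rm loc})$ with $\mathbb P_0(x)\in\mathcal P(x,a_{\rm loc}(x))$ for all $x$. For $x\in\Omega_{\rm loc}$ and $\mathbf a\in\mathcal A$ let $\mathfrak P_{x,\mathbf a}$ be the set of all measures $\delta_x\otimes\mathbb P_0\otimes\mathbb P_1\otimes\cdots$ on $\Omega$ (the law of the process with $X_0=x$ and transition kernel $\mathbb P_t$ from time $t$ to $t+1$), where $\mathbb P_t\in\mathbf P_{a_t}$ for all $t$. Put $$V(x):=\sup_{\mathbf a\in\mathcal A}\inf_{\mathbb P\in\mathfrak P_{x,\mathbf a}}\mathbb E_{\mathbb P}\Big[\sum_{t=0}^\infty\alpha^t r(X_t,a_t(X_t),X_{t+1})\Big],\qquad \mathcal Tv(x):=\sup_{a\in A}\inf_{\mathbb P\in\mathcal P(x,a)}\mathbb E_{\mathbb P}[r(x,a,X_1)+\alpha v(X_1)]$$ for $x\in\Omega_{\rm loc}$ and $v\in C_p$, where under $\mathbb P\in\mathcal M_1(\Omega_{\rm loc})$ the variable $X_1$ has law $\mathbb P$. **Theorem.** For all $x\in\Omega_{\rm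 loc}$, $v\in C_p$ and $\mathbf a\in\mathcal A$: the set $\mathfrak P_{x,\mathbf a}$ is nonempty; all infima and suprema in the definitions of $\mathcal Tv(x)$ and $V(x)$ are finite; $\sum_t\alpha^tr(X_t,a_t(X_t),X_{t+1})$ converges absolutely $\mathbb P$-almost surely and is $\mathbb P$-integrable for every $\mathbb P\in\mathfrak P_{x,\mathbf a}$; and $r(x,a,X_1)+\alpha v(X_1)$ is $\mathbb P$-integrable for all $a\in A$, $\mathbb P\in\mathcal P(x,a)$. Moreover: (i) For every $v\in C_p$ there is a measurable $\mathbb P_0^*:\Omega_{\rm loc}\times A\to\mathcal M_1(\Omega_{\rm loc})$ such that for all $(x,a)$ we have $\mathbb P_0^*(x,a)\in\mathcal P(x,a)$ and $$\mathbb E_{\mathbb P_0^*(x,a)}[r(x,a,X_1)+\alpha v(X_1)]=\inf_{\mathbb P_0\in\mathcal P(x,a)}\mathbb E_{\mathbb P_0}[r(x,a,X_1)+\alpha v(X_1)],\tag{1}$$ and there is $a_{\rm loc}^*\in\mathcal A_{\rm loc}$ such that for all $x$ $$\inf_{\mathbb P_0\in\mathcal P(x,a_{\rm loc}^*(x))}\mathbb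 E_{\mathbb P_0}[r(x,a_{\rm loc}^*(x),X_1)+\alpha v(X_1)]=\sup_{a_{\rm loc}\in\mathcal A_{\rm loc}}\inf_{\mathbb P_0\in\mathcal P(x,a_{\rm loc}(x))}\mathbb E_{\mathbb P_0}[r(x,a_{\rm loc}(x),X_1)+\alpha v(X_1)].\tag{2}$$ For all such $\mathbb P_0^*$, $a_{\rm loc}^*$, the map $\mathbb P_{\rm loc}^*(x):=\mathbb P_0^*(x,a_{\rm loc}^*(x))$ belongs to $\mathbf P_{a_{\rm loc}^*}$, and for all $x$ $$\begin{aligned}\mathcal Tv(x)&=\sup_{a_{\rm loc}\in\mathcal A_{\rm loc}}\inf_{\mathbb P_0\in\mathbf P_{a_{\rm loc}}}\mathbb E_{\mathbb P_0(x)}[r(x,a_{\rm loc}(x),X_1)+\alpha v(X_1)]\\&=\inf_{\mathbb P_0\in\mathbf P_{a_{\rm loc}^*}}\mathbb E_{\mathbb P_0(x)}[r(x,a_{\rm loc}^*(x),X_1)+\alpha v(X_1)]=\mathbb E_{\mathbb P_{\rm loc}^*(x)}[r(x,a_{\rm loc}^*(x),X_1)+\alpha v(X_1)].\end{aligned}$$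 (ii) $\mathcal Tv\in C_p$ for all $v\in C_p$, and $\|\mathcal Tv-\mathcal Tw\|_{C_p}\le\alpha C_P\|v-w\|_{C_p}$ for all $v,w\in C_p$. There is a unique $v\in C_p$ with $\mathcal Tv=v$, and for every $v_0\in C_p$ we have $\|\mathcal T^nv_0-v\|_{C_p}\to0$ as $n\to\infty$. (iii) Let $v\in C_p$ satisfy $\mathcal Tv=v$, let a measurable selector $\mathbb P_0^*$ of $\mathcal P$ and $a_{\rm loc}^*\in\mathcal A_{\rm loc}$ satisfy (1) and (2) for this $v$, and let $\mathbb P_{\rm loc}^*$ be as in (i). Put $\mathbf a^*:=(a_{\rm loc}^*(X_t))_{t\in\mathbb N_0}$ and $\mathbb P_x^*:=\delta_x\otimes\mathbb P_{\rm loc}^*\otimes\mathbb P_{\rm loc}^*\otimes\cdots$. Then for all $x\in\Omega_{\rm loc}$ we have $\mathbb P_x^*\in\mathfrak P_{x,\mathbf a^*}$ and $$\mathbb E_{\mathbb P_x^*}\Big[\sum_{t=0}^\infty\alpha^tr(X_t,a_{\rm loc}^*(X_t),X_{t+1})\Big]=\inf_{\mathbb P\in\mathfrak P_{x,\mathbf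 a^*}}\mathbb E_{\mathbb P}\Big[\sum_{t=0}^\infty\alpha^tr(X_t,a_{\rm loc}^*(X_t),X_{t+1})\Big]=V(x)=v(x).$$ -/

import Mathlib

open MeasureTheory ProbabilityTheory Filter Topology
open scoped ENNReal

namespace RobustMDP

/-- `g ∈ C_p(X, ℝ)` for `X ⊆ ℝᵏ`: `g` is continuous and `|g x| / (1 + ‖x‖ ^ p)` is bounded. -/
def MemCp {k : ℕ} {X : Set (EuclideanSpace ℝ (Fin k))} (p : ℕ) (g : X → ℝ) : Prop :=
  Continuous g ∧
    BddAbove (Set.range fun x : X => |g x| / (1 + ‖(x : EuclideanSpace ℝ (Fin k))‖ ^ p))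

/-- The weighted supremum norm of `C_p(X, ℝ)`. -/
noncomputable def cpNorm {k : ℕ} {X : Set (EuclideanSpace ℝ (Fin k))} (p : ℕ) (g : X → ℝ) : ℝ :=
  ⨆ x : X, |g x| / (1 + ‖(x : EuclideanSpace ℝ (Fin k))‖ ^ p)

/-- Borel probability measures on `S ⊆ ℝᵈ` with finite `p`-th moment (for `p = 0`: all Borel
probability measures).  These are the probability measures against which all functions in
`C_p(S, ℝ)` can be integrated. -/
def MomentMeasure {d : ℕ} (p : ℕ) (S : Set (EuclideanSpace ℝ (Fin d))) : Type :=
  {μ : ProbabilityMeasure S //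
    Integrable (fun y : S => ‖(y : EuclideanSpace ℝ (Fin d))‖ ^ p) (μ : Measure S)}

namespace MomentMeasure

variable {d p : ℕ} {S : Set (EuclideanSpace ℝ (Fin d))}

/-- The underlying measure. -/
def toMeasure (μ : MomentMeasure p S) : Measure S := (μ.1 : Measure S)

instance (μ : MomentMeasure p S) : IsProbabilityMeasure μ.toMeasure :=
  inferInstanceAs (IsProbabilityMeasure (μ.1 : Measure S))

/-- The topology `τ_p`: the coarsest topology for which `μ ↦ ∫ g dμ` is continuous for all
`g ∈ C_p(S, ℝ)`.  Thus `μₙ → μ` iff `∫ g dμₙ → ∫ g dμ` for all `g ∈ C_p(S, ℝ)`. -/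
noncomputable instance : TopologicalSpace (MomentMeasure p S) :=
  ⨅ g : {g : S → ℝ // MemCp p g},
    TopologicalSpace.induced (fun μ : MomentMeasure p S => ∫ y, g.1 y ∂μ.toMeasure) inferInstance

/-- The Borel `σ`-algebra of probability measures, generated by the evaluations `μ ↦ μ B`. -/
instance : MeasurableSpace (MomentMeasure p S) :=
  MeasurableSpace.comap Subtype.val inferInstance

theorem measurable_toMeasure : Measurable (toMeasure : MomentMeasure p S → Measure S) :=
  measurable_subtype_coe.comp (comap_measurable _)

end MomentMeasure

/-- Measurable maps `S → M₁(S)` with values in the measures of finite `p`-th moment. -/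
def TransKernel {d : ℕ} (p : ℕ) (S : Set (EuclideanSpace ℝ (Fin d))) : Type :=
  {κ : S → MomentMeasure p S // Measurable κ}

/-- The set of one-step actions: measurable maps `S → A`. -/
def LocAction {d m : ℕ} (S : Set (EuclideanSpace ℝ (Fin d)))
    (A : Set (EuclideanSpace ℝ (Fin m))) : Type :=
  {a : S → A // Measurable a}

/-- The set of controls: a control is a sequence of measurable maps `aₜ : S → A`; at time `t` the
action `aₜ(Xₜ)` is taken. -/
abbrev Policy {d m : ℕ} (S : Set (EuclideanSpace ℝ (Fin d)))
    (A : Set (EuclideanSpace ℝ (Fin m))) : Type :=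
  ℕ → LocAction S A

section Paths

variable {d p : ℕ} {S : Set (EuclideanSpace ℝ (Fin d))}

/-- A transition kernel as a Markov kernel. -/
noncomputable def TransKernel.toKernel (κ : TransKernel p S) : Kernel S S where
  toFun x := (κ.1 x).toMeasure
  measurable' := MomentMeasure.measurable_toMeasure.comp κ.2

instance (κ : TransKernel p S) : IsMarkovKernel κ.toKernel :=
  ⟨fun x => inferInstanceAs (IsProbabilityMeasure (κ.1 x).toMeasure)⟩

/-- The kernel from histories `(ω₀, …, ωₜ)` to `S` which applies `κ` to the current state `ωₜ`. -/
noncomputable def TransKernel.onHistory (κ : TransKernel p S) (t : ℕ) :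
    Kernel (∀ _ : Finset.Iic t, S) S :=
  κ.toKernel.comap (fun h => h ⟨t, Finset.mem_Iic.2 le_rfl⟩) (measurable_pi_apply _)

instance (κ : TransKernel p S) (t : ℕ) : IsMarkovKernel (κ.onHistory t) :=
  inferInstanceAs (IsMarkovKernel (κ.toKernel.comap _ _))

/-- The measure `δ_x ⊗ κ₀ ⊗ κ₁ ⊗ ⋯` on the path space `S^ℕ` (Ionescu-Tulcea). -/
noncomputable def pathMeasure (x : S) (κ : ℕ → TransKernel p S) : Measure (ℕ → S) :=
  Kernel.trajMeasure (X := fun _ => S) (Measure.dirac x) (fun t => (κ t).onHistory t)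

end Paths

section Model

variable {d m p : ℕ} {S : Set (EuclideanSpace ℝ (Fin d))} {A : Set (EuclideanSpace ℝ (Fin m))}
  (Amb : S × A → Set (MomentMeasure p S)) (r : S → A → S → ℝ) (α : ℝ)

/-- The set of admissible measures on the path space for initial state `x` and control `a`. -/
def admissible (x : S) (a : Policy S A) : Set (Measure (ℕ → S)) :=
  {μ | ∃ κ : ℕ → TransKernel p S,
    (∀ t ω, (κ t).1 ω ∈ Amb (ω, (a t).1 ω)) ∧ μ = pathMeasure x κ}

/-- The discounted total reward `∑ₜ αᵗ r(Xₜ, aₜ(Xₜ), Xₜ₊₁)` along a path `ω`. -/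
noncomputable def totalReward (a : Policy S A) (ω : ℕ → S) : ℝ :=
  ∑' t : ℕ, α ^ t * r (ω t) ((a t).1 (ω t)) (ω (t + 1))

/-- The worst-case expected total reward of the control `a` for the initial state `x`. -/
noncomputable def worstCase (x : S) (a : Policy S A) : ℝ :=
  ⨅ μ : admissible Amb x a, ∫ ω, totalReward r α a ω ∂(μ : Measure (ℕ → S))

/-- The robust value function `V`. -/
noncomputable def value (x : S) : ℝ :=
  ⨆ a : Policy S A, worstCase Amb r α x a

/-- The set `P_a` of kernels compatible with the one-step action `a`. -/
def locKernels (a : LocAction S A) : Set (TransKernel p S) :=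
  {κ | ∀ x, κ.1 x ∈ Amb (x, a.1 x)}

/-- The one-step expectation `E_μ[r(x, a, X₁) + α v(X₁)]`. -/
noncomputable def oneStep (v : S → ℝ) (x : S) (a : A) (μ : MomentMeasure p S) : ℝ :=
  ∫ y, (r x a y + α * v y) ∂μ.toMeasure

/-- The worst-case one-step expectation `inf_{μ ∈ Amb(x, a)} E_μ[r(x, a, X₁) + α v(X₁)]`. -/
noncomputable def worstStep (v : S → ℝ) (x : S) (a : A) : ℝ :=
  ⨅ μ : Amb (x, a), oneStep r α v x a μ.1

/-- The operator `T`. -/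
noncomputable def bellman (v : S → ℝ) (x : S) : ℝ :=
  ⨆ a : A, worstStep Amb r α v x a

/-- `P₀` is a measurable selector of `Amb` attaining the one-step infimum for all `(x, a)`. -/
def IsWorstKernel (v : S → ℝ) (P₀ : S × A → MomentMeasure p S) : Prop :=
  Measurable P₀ ∧ ∀ x a, P₀ (x, a) ∈ Amb (x, a) ∧
    oneStep r α v x a (P₀ (x, a)) = worstStep Amb r α v x a

/-- The one-step action `a` attains, for every `x`, the supremum over all one-step actions of the
worst-case one-step expectation. -/
def IsOptimalAction (v : S → ℝ) (a : LocAction S A) : Prop :=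
  ∀ x, worstStep Amb r α v x (a.1 x) = ⨆ b : LocAction S A, worstStep Amb r α v x (b.1 x)

/-- The kernel `x ↦ P₀(x, a(x))`. -/
def locKernel (P₀ : S × A → MomentMeasure p S) (hP₀ : Measurable P₀) (a : LocAction S A) :
    TransKernel p S :=
  ⟨fun x => P₀ (x, a.1 x), hP₀.comp (measurable_id.prodMk a.2)⟩

end Model

end RobustMDP

/-!
The robust control problem is solved by dynamic programming.

*One-step problem.* For `v ∈ C_p`, the expectation `oneStep r α v x a μ` is jointly continuous in
`(x, a, μ)` (`Assumptions.continuous_oneStep`): continuity in `μ` is the definition of `τ_p`, and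
the modulus of continuity of `r` makes the dependence on `(x, a)` uniform relative to the weight
`1 + ‖y‖ ^ p`, whose integral is locally bounded in `μ`.  By Berge's theorem
(`continuous_iInf_of_hemicontinuous`) the worst case over the compact set `Amb (x, a)` is continuous
in `(x, a)`, and the supremum over the compact action set is continuous in `x`.

*Measurable selection.* Selections are obtained without metrizing `τ_p`.  A compact-valued
correspondence that hits closed sets measurably keeps this property when it is replaced by the set
of minimizers of a continuous function.  Minimizing countably many functions `g 0, g 1, …` in turn
and intersecting gives a selection along which all `g n` are measurable
(`MeasurableCompactValued.exists_selection`).  For measures, the `g n` are integrals of bounded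
continuous functions that determine measurability (`MomentMeasure.exists_determining_sequence`);
for actions, they are the coordinates.

*Fixed point.* The growth condition makes the Bellman operator a contraction of `C_p` with constant
`α * C_P < 1`; dividing by the weight turns `C_p` into the Banach space of bounded continuous
functions, where Banach's fixed-point theorem applies.

*Verification.* Under every admissible measure `E[1 + ‖X_t‖ ^ p] ≤ C_P ^ t (1 + ‖x‖ ^ p)`, so the
discounted rewards are absolutely summable in `L¹`, and by the Markov property the expected total
reward differs from `v x` by the discounted sum of the expected one-step gaps `oneStep … - v`
(`Assumptions.hasSum_oneStep_sub`).  For the fixed point `v`, the gaps are nonnegative for the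
optimal action against any kernels and nonpositive for the worst kernels against any control, so
`v` is the value.
-/

/-! ### Minimization over hemicontinuous correspondences -/

section Correspondence

variable {Z Y : Type*} [TopologicalSpace Z] [TopologicalSpace Y]

theorem IsCompact.bddBelow_range_restrict {K : Set Y} (hK : IsCompact K) {g : Y → ℝ}
    (hg : Continuous g) : BddBelow (Set.range fun y : K => g y) := by
  have := (hK.image hg).bddBelow
  rwa [Set.image_eq_range] at this

theorem IsCompact.exists_eq_iInf {K : Set Y} (hK : IsCompact K) (hne : K.Nonempty) {g : Y → ℝ}
    (hg : Continuous g) : ∃ y ∈ K, g y = ⨅ y : K, g y := by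
  obtain ⟨y, hy, hmin⟩ := hK.exists_isMinOn hne hg.continuousOn
  have := hne.to_subtype
  exact ⟨y, hy, le_antisymm (le_ciInf fun y' => hmin y'.2)
    (ciInf_le (hK.bddBelow_range_restrict hg) ⟨y, hy⟩)⟩

theorem UpperHemicontinuous.isClosed_exists_le {K : Z → Set Y} (hK : UpperHemicontinuous K)
    (hcpt : ∀ z, IsCompact (K z)) {f : Z × Y → ℝ} (hf : Continuous f) {g : Z → ℝ}
    (hg : Continuous g) : IsClosed {z | ∃ y ∈ K z, f (z, y) ≤ g z} := by
  rw [← isOpen_compl_iff, isOpen_iff_mem_nhds]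
  intro z hz
  have hz' : ∀ y ∈ K z, g z < f (z, y) := by simpa using hz
  have hn : IsOpen {q : Z × Y | g q.1 < f q} := isOpen_lt (hg.comp continuous_fst) hf
  obtain ⟨u, v, hu, hv, hzu, hKv, huv⟩ :=
    generalized_tube_lemma (isCompact_singleton (x := z)) (hcpt z) hn (by
      rintro ⟨z', y⟩ ⟨h1, h2⟩
      obtain rfl : z' = z := h1
      exact hz' y h2)
  filter_upwards [hu.mem_nhds (hzu rfl), upperHemicontinuous_iff_forall_isOpen.1 hK z v hv hKv]
    with z' hz'u hz'v
  simp only [Set.mem_compl_iff, Set.mem_ofPred_eq, not_exists, not_and, not_le]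
  exact fun y hy => huv (Set.mk_mem_prod hz'u (hz'v hy))

theorem LowerHemicontinuous.isOpen_exists_lt {K : Z → Set Y} (hK : LowerHemicontinuous K)
    {f : Z × Y → ℝ} (hf : Continuous f) (c : ℝ) : IsOpen {z | ∃ y ∈ K z, f (z, y) < c} := by
  rw [isOpen_iff_mem_nhds]
  rintro z ⟨y, hy, hyc⟩
  obtain ⟨u, v, hu, hv, hzu, hyv, huv⟩ :=
    isOpen_prod_iff.1 (isOpen_lt hf continuous_const) z y hyc
  filter_upwards [hu.mem_nhds hzu,
    (lowerHemicontinuous_iff_isOpen_inter_nonempty.1 hK v hv).mem_nhds ⟨y, hy, hyv⟩] with z' hz'u hz'v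
  obtain ⟨y', hy', hy'v⟩ := hz'v
  exact ⟨y', hy', huv (Set.mk_mem_prod hz'u hy'v)⟩

/-- **Berge's maximum theorem**, for minima of real functions. -/
theorem continuous_iInf_of_hemicontinuous {K : Z → Set Y} (hup : UpperHemicontinuous K)
    (hlow : LowerHemicontinuous K) (hcpt : ∀ z, IsCompact (K z)) (hne : ∀ z, (K z).Nonempty)
    {f : Z × Y → ℝ} (hf : Continuous f) : Continuous fun z => ⨅ y : K z, f (z, y) := by
  have hfz : ∀ z, Continuous fun y => f (z, y) := fun z => by fun_prop
  have hbdd := fun z => (hcpt z).bddBelow_range_restrict (hfz z)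
  have hatt := fun z => (hcpt z).exists_eq_iInf (hne z) (hfz z)
  refine continuous_iff_lower_upperSemicontinuous.2
    ⟨lowerSemicontinuous_iff_isClosed_preimage.2 fun c => ?_,
      upperSemicontinuous_iff_isOpen_preimage.2 fun c => ?_⟩
  · convert hup.isClosed_exists_le hcpt hf (continuous_const (y := c)) using 1
    ext z
    refine ⟨fun h => ?_, fun ⟨y, hy, hyc⟩ => (ciInf_le (hbdd z) ⟨y, hy⟩).trans hyc⟩
    obtain ⟨y, hy, hyc⟩ := hatt z
    exact ⟨y, hy, hyc.trans_le h⟩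
  · convert hlow.isOpen_exists_lt hf c using 1
    ext z
    refine ⟨fun h => ?_, fun ⟨y, hy, hyc⟩ => (ciInf_le (hbdd z) ⟨y, hy⟩).trans_lt hyc⟩
    obtain ⟨y, hy, hyc⟩ := hatt z
    exact ⟨y, hy, hyc.trans_lt h⟩

end Correspondence

/-! ### Measurable selections by successive minimization -/

section Selection

variable {Z Y : Type*} [MeasurableSpace Z] [TopologicalSpace Y]

/-- A correspondence with nonempty compact values which is (weakly) measurable: it hits every
closed set on a measurable set of parameters. -/
structure MeasurableCompactValued (K : Z → Set Y) : Prop where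
  nonempty : ∀ z, (K z).Nonempty
  isCompact : ∀ z, IsCompact (K z)
  measurableSet_hit : ∀ F, IsClosed F → MeasurableSet {z | (K z ∩ F).Nonempty}

/-- The points of `K z` at which `g` is minimal. -/
def minimizers (K : Z → Set Y) (g : Y → ℝ) (z : Z) : Set Y :=
  {y ∈ K z | ∀ y' ∈ K z, g y ≤ g y'}

theorem MeasurableCompactValued.minimizers [T2Space Y] {K : Z → Set Y}
    (hK : MeasurableCompactValued K) {g : Y → ℝ} (hg : Continuous g) :
    MeasurableCompactValued (minimizers K g) where
  nonempty z := by
    obtain ⟨y, hy, hmin⟩ := (hK.isCompact z).exists_isMinOn (hK.nonempty z) hg.continuousOn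
    exact ⟨y, hy, fun y' hy' => hmin hy'⟩
  isCompact z := by
    have : _root_.minimizers K g z = K z ∩ ⋂ y' ∈ K z, {y | g y ≤ g y'} := by
      ext y; simp [_root_.minimizers]
    rw [this]
    exact (hK.isCompact z).inter_right
      (isClosed_biInter fun y' _ => isClosed_le hg continuous_const)
  measurableSet_hit F hF := by
    -- A minimizer lies in `F` iff every rational sublevel set which meets `K z` meets `K z ∩ F`.
    have key : {z | (_root_.minimizers K g z ∩ F).Nonempty} =
        ⋂ q : ℚ, {z | (K z ∩ {y | g y ≤ q}).Nonempty}ᶜ ∪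
          {z | (K z ∩ (F ∩ {y | g y ≤ q})).Nonempty} := by
      ext z
      simp only [Set.mem_iInter, Set.mem_union, Set.mem_compl_iff, Set.mem_ofPred_eq]
      constructor
      · rintro ⟨y, ⟨hyK, hymin⟩, hyF⟩ q
        by_cases h : (K z ∩ {y | g y ≤ q}).Nonempty
        · obtain ⟨y', hy'K, hy'q⟩ := h
          exact Or.inr ⟨y, hyK, hyF, (hymin y' hy'K).trans hy'q⟩
        · exact Or.inl h
      · intro h
        replace h : ∀ (q : ℚ), ∀ y ∈ K z, g y ≤ q → ∃ y' ∈ K z, y' ∈ F ∧ g y' ≤ q := by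
          intro q y hy hyq
          rcases h q with h | ⟨y', h1, h2, h3⟩
          · exact absurd ⟨y, hy, hyq⟩ h
          · exact ⟨y', h1, h2, h3⟩
        have hne : (K z ∩ F).Nonempty := by
          obtain ⟨y, hy⟩ := hK.nonempty z
          obtain ⟨q, hq⟩ := exists_rat_gt (g y)
          obtain ⟨y', h1, h2, -⟩ := h q y hy hq.le
          exact ⟨y', h1, h2⟩
        obtain ⟨y, hy, hmin⟩ :=
          ((hK.isCompact z).inter_right hF).exists_isMinOn hne hg.continuousOn
        refine ⟨y, ⟨hy.1, fun y' hy' => ?_⟩, hy.2⟩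
        by_contra! hlt
        obtain ⟨q, hq1, hq2⟩ := exists_rat_btwn hlt
        obtain ⟨y'', h1, h2, h3⟩ := h q y' hy' hq1.le
        exact absurd (hmin ⟨h1, h2⟩) (not_le.2 (h3.trans_lt hq2))
    rw [key]
    have hcl : ∀ q : ℚ, IsClosed {y | g y ≤ q} := fun q => isClosed_le hg continuous_const
    exact MeasurableSet.iInter fun q => (hK.measurableSet_hit _ (hcl q)).compl.union
      (hK.measurableSet_hit _ (hF.inter (hcl q)))

/-- Minimizing `g 0, g 1, …` one after the other over a measurable compact-valued correspondence
gives a selection along which every `g n` is measurable: at the selected point, `g n` equals its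
minimum over the set that remains after the first `n` minimizations. -/
theorem MeasurableCompactValued.exists_selection [T2Space Y] {K : Z → Set Y}
    (hK : MeasurableCompactValued K) (g : ℕ → Y → ℝ) (hg : ∀ n, Continuous (g n)) :
    ∃ s : Z → Y, (∀ z, s z ∈ K z) ∧ ∀ n, Measurable fun z => g n (s z) := by
  let J : ℕ → Z → Set Y := fun n => Nat.rec K (fun n Kn => _root_.minimizers Kn (g n)) n
  have hJ : ∀ n, MeasurableCompactValued (J n) := by
    intro n
    induction n with
    | zero => exact hK
    | succ n ih => exact ih.minimizers (hg n)
  have hne : ∀ z, (⋂ n, J n z).Nonempty := fun z =>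
    IsCompact.nonempty_iInter_of_sequence_nonempty_isCompact_isClosed (fun n => J n z)
      (fun n => Set.sep_subset _ _) (fun n => (hJ n).nonempty z) (hK.isCompact z)
      (fun n => ((hJ n).isCompact z).isClosed)
  choose s hs using hne
  have hs' : ∀ n z, s z ∈ J n z := fun n z => Set.mem_iInter.1 (hs z) n
  refine ⟨s, hs' 0, fun n => measurable_of_Iic fun c => ?_⟩
  convert (hJ n).measurableSet_hit {y | g n y ≤ c} (isClosed_le (hg n) continuous_const) using 1
  ext z
  refine ⟨fun h => ⟨s z, hs' n z, h⟩, fun ⟨y, hy, hyc⟩ => ?_⟩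
  exact ((hs' (n + 1) z).2 y hy).trans hyc

/-- A selection of minimizers in Berge's theorem along which countably many prescribed continuous
functions are measurable. -/
theorem exists_selection_isMin {Z : Type*} [TopologicalSpace Z] [MeasurableSpace Z] [BorelSpace Z]
    [T2Space Y] {K : Z → Set Y} (hup : UpperHemicontinuous K)
    (hlow : LowerHemicontinuous K) (hcpt : ∀ z, IsCompact (K z)) (hne : ∀ z, (K z).Nonempty)
    {f : Z × Y → ℝ} (hf : Continuous f) (g : ℕ → Y → ℝ) (hg : ∀ n, Continuous (g n)) :
    ∃ s : Z → Y, (∀ z, s z ∈ K z ∧ f (z, s z) = ⨅ y : K z, f (z, y)) ∧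
      ∀ n, Measurable fun z => g n (s z) := by
  have hm := continuous_iInf_of_hemicontinuous hup hlow hcpt hne hf
  have hfz : ∀ z, Continuous fun y => f (z, y) := fun z => by fun_prop
  have hK : MeasurableCompactValued fun z => K z ∩ {y | f (z, y) ≤ ⨅ y : K z, f (z, y)} :=
    { nonempty := fun z => by
        obtain ⟨y, hy, hyz⟩ := (hcpt z).exists_eq_iInf (hne z) (hfz z)
        exact ⟨y, hy, hyz.le⟩
      isCompact := fun z => (hcpt z).inter_right (isClosed_le (hfz z) continuous_const)
      measurableSet_hit := fun F hF => by
        have h := (hup.inter hF).isClosed_exists_le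
          (fun z => (hcpt z).inter_right hF) hf hm
        convert h.measurableSet using 1
        ext z
        exact ⟨fun ⟨y, h1, h2⟩ => ⟨y, ⟨h1.1, h2⟩, h1.2⟩,
          fun ⟨y, h1, h2⟩ => ⟨y, ⟨h1.1, h2⟩, h1.2⟩⟩ }
  obtain ⟨s, hs, hsm⟩ := hK.exists_selection g hg
  exact ⟨s, fun z => ⟨(hs z).1, le_antisymm (hs z).2
    (ciInf_le ((hcpt z).bddBelow_range_restrict (hfz z)) ⟨s z, (hs z).1⟩)⟩, hsm⟩

end Selection

/-- Measurability of a family of probability measures can be tested on countably many bounded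
continuous functions: approximations of the indicators of the complements of finite unions of
basic open sets. -/
theorem exists_measurability_determining_sequence (X : Type*) [TopologicalSpace X]
    [SecondCountableTopology X] [HasOuterApproxClosed X] [MeasurableSpace X] [BorelSpace X] :
    ∃ g : ℕ → BoundedContinuousFunction X NNReal, ∀ {Z : Type} [MeasurableSpace Z]
      (μ : Z → Measure X) [∀ z, IsProbabilityMeasure (μ z)],
      (∀ n, Measurable fun z => ∫⁻ x, g n x ∂μ z) → Measurable μ := by
  let B := TopologicalSpace.countableBasis X
  have hB := TopologicalSpace.isBasis_countableBasis X
  have : Countable B := (TopologicalSpace.countable_countableBasis X).to_subtype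
  let F : Finset B → Set X := fun s => (⋃ b ∈ s, (b : Set X))ᶜ
  have hF : ∀ s, IsClosed (F s) := fun s =>
    (isOpen_biUnion fun b _ => hB.isOpen b.2).isClosed_compl
  obtain ⟨e, he⟩ := exists_surjective_nat (Finset B × ℕ)
  refine ⟨fun n => (hF (e n).1).apprSeq (e n).2, fun {Z} _ μ _ hμ => ?_⟩
  refine Measurable.measure_of_isPiSystem_of_isProbabilityMeasure (S := Set.range F) ?_ ?_ ?_
  · apply le_antisymm
    · rw [BorelSpace.measurable_eq (α := X), hB.borel_eq_generateFrom]
      refine MeasurableSpace.generateFrom_le fun b hb => ?_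
      have : b = (F {⟨b, hb⟩})ᶜ := by
        simp only [F, compl_compl, Finset.mem_singleton, Set.iUnion_iUnion_eq_left]
      rw [this]
      exact (MeasurableSpace.measurableSet_generateFrom (Set.mem_range_self _)).compl
    · refine MeasurableSpace.generateFrom_le ?_
      rintro _ ⟨s, rfl⟩
      exact (hF s).measurableSet
  · classical
    rintro _ ⟨s, rfl⟩ _ ⟨t, rfl⟩ -
    refine ⟨s ∪ t, ?_⟩
    simp only [F, ← Set.compl_union]
    congr 1
    ext x
    simp only [Set.mem_iUnion, Finset.mem_union, Set.mem_union]
    aesop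
  · rintro _ ⟨s, rfl⟩
    refine measurable_of_tendsto_metrizable (f := fun n z => ∫⁻ x, (hF s).apprSeq n x ∂μ z) ?_
      (tendsto_pi_nhds.2 fun z => HasOuterApproxClosed.tendsto_lintegral_apprSeq (hF s) (μ z))
    intro n
    obtain ⟨k, hk⟩ := he (s, n)
    have := hμ k
    simp only [hk] at this
    exact this

namespace RobustMDP

/-! ### Weighted continuous functions and moment measures -/

section Weight

theorem abs_integral_le {X : Type*} [MeasurableSpace X] {μ : Measure X} {f g : X → ℝ}
    (hg : Integrable g μ) (h : ∀ x, |f x| ≤ g x) : |∫ x, f x ∂μ| ≤ ∫ x, g x ∂μ :=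
  (Real.norm_eq_abs _).symm.trans_le (norm_integral_le_of_norm_le hg (ae_of_all _ h))

variable {d p : ℕ} {S : Set (EuclideanSpace ℝ (Fin d))}

/-- The weight `1 + ‖x‖ ^ p` of the norm of `C_p`. -/
noncomputable def weight (p : ℕ) (x : S) : ℝ := 1 + ‖(x : EuclideanSpace ℝ (Fin d))‖ ^ p

theorem one_le_weight (x : S) : 1 ≤ weight p x := by
  have : 0 ≤ ‖(x : EuclideanSpace ℝ (Fin d))‖ ^ p := by positivity
  unfold weight
  linarith

theorem weight_pos (x : S) : 0 < weight p x := zero_lt_one.trans_le (one_le_weight x)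

theorem continuous_weight : Continuous (weight p : S → ℝ) := by
  unfold weight
  fun_prop

theorem memCp_of_abs_le {g : S → ℝ} (hg : Continuous g) {C : ℝ}
    (h : ∀ x, |g x| ≤ C * weight p x) : MemCp p g :=
  ⟨hg, C, by rintro _ ⟨x, rfl⟩; exact (div_le_iff₀ (weight_pos x)).2 (h x)⟩

theorem memCp_weight : MemCp p (weight p : S → ℝ) :=
  memCp_of_abs_le (C := 1) continuous_weight fun x => by
    rw [one_mul, abs_of_pos (weight_pos x)]

theorem MemCp.abs_le {g : S → ℝ} (hg : MemCp p g) (x : S) : |g x| ≤ cpNorm p g * weight p x :=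
  (div_le_iff₀ (weight_pos x)).1 (le_ciSup hg.2 x)

theorem cpNorm_nonneg (g : S → ℝ) : 0 ≤ cpNorm p g :=
  Real.iSup_nonneg fun x => div_nonneg (abs_nonneg _) (weight_pos x).le

/-- The condition `0 ≤ C` is needed when `S` is empty, where the supremum is `0` by convention. -/
theorem cpNorm_le {g : S → ℝ} {C : ℝ} (hC : 0 ≤ C) (h : ∀ x, |g x| ≤ C * weight p x) :
    cpNorm p g ≤ C :=
  Real.iSup_le (fun x => (div_le_iff₀ (weight_pos x)).2 (h x)) hC

theorem MemCp.sub {g h : S → ℝ} (hg : MemCp p g) (hh : MemCp p h) : MemCp p (g - h) :=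
  memCp_of_abs_le (C := cpNorm p g + cpNorm p h) (hg.1.sub hh.1) fun x => by
    rw [add_mul]
    exact (abs_sub _ _).trans (add_le_add (hg.abs_le x) (hh.abs_le x))

end Weight

namespace MomentMeasure

variable {d p : ℕ} {S : Set (EuclideanSpace ℝ (Fin d))}

theorem integrable_weight (μ : MomentMeasure p S) : Integrable (weight p) μ.toMeasure :=
  (integrable_const (1 : ℝ)).add μ.2

theorem integrable (μ : MomentMeasure p S) {g : S → ℝ} (hg : MemCp p g) :
    Integrable g μ.toMeasure :=
  (μ.integrable_weight.const_mul (cpNorm p g)).mono' hg.1.measurable.aestronglyMeasurable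
    (ae_of_all _ hg.abs_le)

theorem continuous_integral {g : S → ℝ} (hg : MemCp p g) :
    Continuous fun μ : MomentMeasure p S => ∫ y, g y ∂μ.toMeasure :=
  continuous_iInf_dom (i := (⟨g, hg⟩ : {g : S → ℝ // MemCp p g})) continuous_induced_dom

theorem memCp_boundedContinuousFunction (g : BoundedContinuousFunction S ℝ) : MemCp p g :=
  memCp_of_abs_le (C := ‖g‖) g.continuous fun x =>
    (g.norm_coe_le_norm x).trans (le_mul_of_one_le_right (norm_nonneg _) (one_le_weight x))

theorem toMeasure_injective :
    Function.Injective (toMeasure : MomentMeasure p S → Measure S) := fun _ _ h =>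
  Subtype.ext (Subtype.ext h)

instance : T2Space (MomentMeasure p S) :=
  T2Space.of_injective_continuous
    (f := fun (μ : MomentMeasure p S) (g : BoundedContinuousFunction S ℝ) =>
      ∫ y, g y ∂μ.toMeasure)
    (fun _ _ h => toMeasure_injective
      (ext_of_forall_integral_eq_of_IsFiniteMeasure fun g => congrFun h g))
    (continuous_pi fun g => continuous_integral (memCp_boundedContinuousFunction g))

theorem measurable_of_toMeasure {Z : Type*} [MeasurableSpace Z] {κ : Z → MomentMeasure p S}
    (h : Measurable fun z => (κ z).toMeasure) : Measurable κ :=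
  measurable_comap_iff.2 (Measurable.subtype_mk h)

/-- Countably many `τ_p`-continuous functionals determine the measurability of maps into the space
of moment measures. -/
theorem exists_determining_sequence :
    ∃ g : ℕ → MomentMeasure p S → ℝ, (∀ n, Continuous (g n)) ∧
      ∀ {Z : Type} [MeasurableSpace Z] (κ : Z → MomentMeasure p S),
        (∀ n, Measurable fun z => g n (κ z)) → Measurable κ := by
  obtain ⟨g, hg⟩ := exists_measurability_determining_sequence S
  have hb : ∀ n, MemCp p fun y => (g n y : ℝ) := fun n =>
    memCp_of_abs_le (C := dist (g n) 0) (by fun_prop) fun y => by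
      have h : |(g n y : ℝ) - 0| ≤ dist (g n) 0 := (g n).dist_coe_le_dist (g := 0) y
      rw [sub_zero] at h
      exact h.trans (le_mul_of_one_le_right dist_nonneg (one_le_weight y))
  refine ⟨fun n μ => ∫ y, (g n y : ℝ) ∂μ.toMeasure, fun n => continuous_integral (hb n),
    fun {Z} _ κ hκ => measurable_of_toMeasure (hg _ fun n => ?_)⟩
  have : ∀ z, ∫⁻ y, g n y ∂(κ z).toMeasure =
      ENNReal.ofReal (∫ y, (g n y : ℝ) ∂(κ z).toMeasure) := fun z => by
    rw [ofReal_integral_eq_lintegral_ofReal ((κ z).integrable (hb n))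
      (ae_of_all _ fun y => (g n y).coe_nonneg)]
    simp
  simp_rw [this]
  exact (hκ n).ennreal_ofReal

end MomentMeasure

/-! ### The one-step problem -/

section Model

variable {d m p : ℕ} {S : Set (EuclideanSpace ℝ (Fin d))} {A : Set (EuclideanSpace ℝ (Fin m))}

/-- The standing assumptions on the ambiguity correspondence, the reward and the discount factor.
The modulus of continuity of the reward enters only through local equicontinuity relative to the
weight. -/
structure Assumptions (Amb : S × A → Set (MomentMeasure p S)) (r : S → A → S → ℝ)
    (α C_P C_r : ℝ) : Prop where
  nonempty : ∀ z, (Amb z).Nonempty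
  isCompact : ∀ z, IsCompact (Amb z)
  upper : UpperHemicontinuous Amb
  lower : LowerHemicontinuous Amb
  one_le_C_P : 1 ≤ C_P
  growth : ∀ (x : S) (a : A), ∀ μ ∈ Amb (x, a), ∫ y, weight p y ∂μ.toMeasure ≤ C_P * weight p x
  continuous_reward : Continuous fun z : S × A × S => r z.1 z.2.1 z.2.2
  reward_equicontinuous : ∀ z : S × A, ∀ ε > 0, ∀ᶠ z' in 𝓝 z, ∀ y,
    |r z'.1 z'.2 y - r z.1 z.2 y| ≤ ε * weight p y
  one_le_C_r : 1 ≤ C_r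
  reward_growth : ∀ x a y, |r x a y| ≤ C_r * (weight p x + weight p y)
  α_pos : 0 < α
  α_mul_lt_one : α * C_P < 1

namespace Assumptions

variable {Amb : S × A → Set (MomentMeasure p S)} {r : S → A → S → ℝ} {α C_P C_r : ℝ}
  (H : Assumptions Amb r α C_P C_r) {v w : S → ℝ}

include H

theorem memCp_integrand (hv : MemCp p v) (x : S) (a : A) :
    MemCp p fun y => r x a y + α * v y := by
  have hc := H.continuous_reward
  refine memCp_of_abs_le (C := C_r * (weight p x + 1) + α * cpNorm p v) ?_ fun y => ?_
  · exact (hc.comp (by fun_prop : Continuous fun y : S => (x, a, y))).add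
      (continuous_const.mul hv.1)
  · have h1 := H.reward_growth x a y
    have h2 := mul_le_mul_of_nonneg_left (hv.abs_le y) H.α_pos.le
    have h3 : weight p x * 1 ≤ weight p x * weight p y :=
      mul_le_mul_of_nonneg_left (one_le_weight y) (weight_pos x).le
    have h4 : C_r * (weight p x + weight p y) ≤
        C_r * (weight p x * weight p y + weight p y) :=
      mul_le_mul_of_nonneg_left (by linarith) (zero_le_one.trans H.one_le_C_r)
    calc |r x a y + α * v y| ≤ |r x a y| + |α * v y| := abs_add_le _ _
      _ = |r x a y| + α * |v y| := by rw [abs_mul, abs_of_pos H.α_pos]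
      _ ≤ _ := by linarith

/-- The expectation is continuous in the measure by definition of `τ_p`; moving `(x, a)` changes it
by at most `ε * ∫ weight`, and the integral of the weight is locally bounded in the measure. -/
theorem continuous_oneStep (hv : MemCp p v) :
    Continuous fun q : (S × A) × MomentMeasure p S => oneStep r α v q.1.1 q.1.2 q.2 := by
  rw [continuous_iff_continuousAt]
  rintro ⟨z, μ⟩
  have hW : ContinuousAt (fun q : (S × A) × MomentMeasure p S =>
      ∫ y, weight p y ∂q.2.toMeasure) (z, μ) :=
    ((MomentMeasure.continuous_integral memCp_weight).comp continuous_snd).continuousAt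
  have hf : ContinuousAt (fun q : (S × A) × MomentMeasure p S =>
      oneStep r α v z.1 z.2 q.2) (z, μ) :=
    ((MomentMeasure.continuous_integral (H.memCp_integrand hv z.1 z.2)).comp
      continuous_snd).continuousAt
  have hdiff : Tendsto (fun q : (S × A) × MomentMeasure p S =>
      oneStep r α v q.1.1 q.1.2 q.2 - oneStep r α v z.1 z.2 q.2) (𝓝 (z, μ)) (𝓝 0) := by
    rw [Metric.tendsto_nhds]
    intro ε hε
    set W := ∫ y, weight p y ∂μ.toMeasure with hW_def
    have hWnn : 0 ≤ W := integral_nonneg fun y => (weight_pos y).le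
    have hδ : 0 < ε / (W + 1) := by positivity
    have h1 : ∀ᶠ q : (S × A) × MomentMeasure p S in 𝓝 (z, μ),
        ∫ y, weight p y ∂q.2.toMeasure < W + 1 := hW.eventually_lt_const (by linarith)
    have h2 : ∀ᶠ q : (S × A) × MomentMeasure p S in 𝓝 (z, μ), ∀ y,
        |r q.1.1 q.1.2 y - r z.1 z.2 y| ≤ ε / (W + 1) * weight p y :=
      (continuous_fst.tendsto (z, μ)).eventually (H.reward_equicontinuous z _ hδ)
    filter_upwards [h1, h2] with q hq1 hq2
    rw [Real.dist_0_eq_abs, oneStep, oneStep, ← integral_sub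
      (q.2.integrable (H.memCp_integrand hv _ _)) (q.2.integrable (H.memCp_integrand hv _ _))]
    calc |∫ y, (r q.1.1 q.1.2 y + α * v y - (r z.1 z.2 y + α * v y)) ∂q.2.toMeasure|
        ≤ ∫ y, ε / (W + 1) * weight p y ∂q.2.toMeasure := by
          refine abs_integral_le (q.2.integrable_weight.const_mul _)
            fun y => ?_
          rw [add_sub_add_right_eq_sub]
          exact hq2 y
      _ = ε / (W + 1) * ∫ y, weight p y ∂q.2.toMeasure := integral_const_mul _ _
      _ < ε / (W + 1) * (W + 1) := mul_lt_mul_of_pos_left hq1 hδ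
      _ = ε := div_mul_cancel₀ _ (by positivity)
  have := hdiff.add hf
  simpa [ContinuousAt] using this

theorem abs_oneStep_le {c : ℝ} (hv : ∀ y, |v y| ≤ c * weight p y) (hc : 0 ≤ c)
    {x : S} {a : A} {μ : MomentMeasure p S} (hμ : μ ∈ Amb (x, a)) :
    |oneStep r α v x a μ| ≤ (C_r * (1 + C_P) + α * c * C_P) * weight p x := by
  have hCr := zero_le_one.trans H.one_le_C_r
  have hα := H.α_pos
  have hint : Integrable (fun y => C_r * weight p x + (C_r + α * c) * weight p y) μ.toMeasure :=
    (integrable_const _).add (μ.integrable_weight.const_mul _)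
  calc |oneStep r α v x a μ|
      ≤ ∫ y, (C_r * weight p x + (C_r + α * c) * weight p y) ∂μ.toMeasure := by
        refine abs_integral_le hint fun y => ?_
        have h1 := H.reward_growth x a y
        have h2 := mul_le_mul_of_nonneg_left (hv y) hα.le
        calc |r x a y + α * v y| ≤ |r x a y| + |α * v y| := abs_add_le _ _
          _ = |r x a y| + α * |v y| := by rw [abs_mul, abs_of_pos hα]
          _ ≤ _ := by linarith
    _ = C_r * weight p x + (C_r + α * c) * ∫ y, weight p y ∂μ.toMeasure := by
        rw [integral_add (integrable_const _) (μ.integrable_weight.const_mul _),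
          integral_const_mul (C_r + α * c), integral_const]
        simp
    _ ≤ C_r * weight p x + (C_r + α * c) * (C_P * weight p x) := by
        gcongr
        exact H.growth x a μ hμ
    _ = _ := by ring

theorem abs_oneStep_sub_le (hv : MemCp p v) (hw : MemCp p w) {x : S} {a : A}
    {μ : MomentMeasure p S} (hμ : μ ∈ Amb (x, a)) :
    |oneStep r α v x a μ - oneStep r α w x a μ| ≤ α * C_P * cpNorm p (v - w) * weight p x := by
  have hα := H.α_pos
  have hn := cpNorm_nonneg (p := p) (v - w)
  rw [oneStep, oneStep, ← integral_sub (μ.integrable (H.memCp_integrand hv _ _))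
    (μ.integrable (H.memCp_integrand hw _ _))]
  calc |∫ y, (r x a y + α * v y - (r x a y + α * w y)) ∂μ.toMeasure|
      ≤ ∫ y, α * cpNorm p (v - w) * weight p y ∂μ.toMeasure := by
        refine abs_integral_le (μ.integrable_weight.const_mul _)
          fun y => ?_
        rw [add_sub_add_left_eq_sub, ← mul_sub, abs_mul, abs_of_pos hα, mul_assoc]
        exact mul_le_mul_of_nonneg_left ((hv.sub hw).abs_le y) hα.le
    _ = α * cpNorm p (v - w) * ∫ y, weight p y ∂μ.toMeasure := integral_const_mul _ _
    _ ≤ α * cpNorm p (v - w) * (C_P * weight p x) := by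
        gcongr
        exact H.growth x a μ hμ
    _ = _ := by ring

theorem bddBelow_oneStep (hv : MemCp p v) (x : S) (a : A) :
    BddBelow (Set.range fun μ : Amb (x, a) => oneStep r α v x a μ.1) :=
  (H.isCompact (x, a)).bddBelow_range_restrict
    ((H.continuous_oneStep hv).comp (by fun_prop : Continuous fun μ => ((x, a), μ)))

theorem worstStep_le (hv : MemCp p v) {x : S} {a : A} {μ : MomentMeasure p S}
    (hμ : μ ∈ Amb (x, a)) : worstStep Amb r α v x a ≤ oneStep r α v x a μ :=
  ciInf_le (H.bddBelow_oneStep hv x a) ⟨μ, hμ⟩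

theorem exists_oneStep_eq_worstStep (hv : MemCp p v) (x : S) (a : A) :
    ∃ μ ∈ Amb (x, a), oneStep r α v x a μ = worstStep Amb r α v x a :=
  (H.isCompact (x, a)).exists_eq_iInf (H.nonempty (x, a))
    ((H.continuous_oneStep hv).comp (by fun_prop : Continuous fun μ => ((x, a), μ)))

theorem continuous_worstStep (hv : MemCp p v) :
    Continuous fun z : S × A => worstStep Amb r α v z.1 z.2 :=
  continuous_iInf_of_hemicontinuous H.upper H.lower H.isCompact H.nonempty
    (H.continuous_oneStep hv)

theorem exists_isWorstKernel (hv : MemCp p v) :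
    ∃ P₀ : S × A → MomentMeasure p S, IsWorstKernel Amb r α v P₀ := by
  obtain ⟨g, hg, hmeas⟩ := MomentMeasure.exists_determining_sequence (p := p) (S := S)
  obtain ⟨P₀, hP₀, hP₀m⟩ := exists_selection_isMin H.upper H.lower H.isCompact H.nonempty
    (H.continuous_oneStep hv) g hg
  exact ⟨P₀, hmeas P₀ hP₀m, fun x a => hP₀ (x, a)⟩

theorem abs_worstStep_le (hv : MemCp p v) (x : S) (a : A) :
    |worstStep Amb r α v x a| ≤
      (C_r * (1 + C_P) + α * cpNorm p v * C_P) * weight p x := by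
  obtain ⟨μ, hμ, h⟩ := H.exists_oneStep_eq_worstStep hv x a
  rw [← h]
  exact H.abs_oneStep_le hv.abs_le (cpNorm_nonneg v) hμ

theorem worstStep_le_add (hv : MemCp p v) (hw : MemCp p w) (x : S) (a : A) :
    worstStep Amb r α v x a ≤
      worstStep Amb r α w x a + α * C_P * cpNorm p (v - w) * weight p x := by
  obtain ⟨μ, hμ, h⟩ := H.exists_oneStep_eq_worstStep hw x a
  have h1 := H.worstStep_le hv hμ
  have h2 := (abs_le.1 (H.abs_oneStep_sub_le hv hw hμ)).2
  linarith

theorem bddAbove_worstStep (hv : MemCp p v) (x : S) :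
    BddAbove (Set.range fun a : A => worstStep Amb r α v x a) :=
  ⟨_, by rintro _ ⟨a, rfl⟩; exact (abs_le.1 (H.abs_worstStep_le hv x a)).2⟩

theorem worstStep_le_bellman (hv : MemCp p v) (x : S) (a : A) :
    worstStep Amb r α v x a ≤ bellman Amb r α v x :=
  le_ciSup (H.bddAbove_worstStep hv x) a

theorem continuous_bellman [CompactSpace A] (hv : MemCp p v) : Continuous (bellman Amb r α v) := by
  have := IsCompact.continuous_sSup (f := fun x a => worstStep Amb r α v x a)
    (isCompact_univ (X := A)) (H.continuous_worstStep hv)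
  simp only [Set.image_univ] at this
  exact this

variable [Nonempty A]

theorem abs_bellman_le (hv : MemCp p v) (x : S) :
    |bellman Amb r α v x| ≤ (C_r * (1 + C_P) + α * cpNorm p v * C_P) * weight p x := by
  refine abs_le.2 ⟨?_, ciSup_le fun a => (abs_le.1 (H.abs_worstStep_le hv x a)).2⟩
  exact (abs_le.1 (H.abs_worstStep_le hv x (Classical.arbitrary A))).1.trans
    (H.worstStep_le_bellman hv x _)

theorem memCp_bellman [CompactSpace A] (hv : MemCp p v) : MemCp p (bellman Amb r α v) :=
  memCp_of_abs_le (H.continuous_bellman hv) (H.abs_bellman_le hv)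

theorem bellman_le_add (hv : MemCp p v) (hw : MemCp p w) (x : S) :
    bellman Amb r α v x ≤
      bellman Amb r α w x + α * C_P * cpNorm p (v - w) * weight p x :=
  ciSup_le fun a => (H.worstStep_le_add hv hw x a).trans
    (add_le_add_left (H.worstStep_le_bellman hw x a) _)

omit H in
theorem cpNorm_sub_comm (v w : S → ℝ) : cpNorm p (v - w) = cpNorm p (w - v) := by
  simp [cpNorm, abs_sub_comm]

theorem cpNorm_bellman_sub_le (hv : MemCp p v) (hw : MemCp p w) :
    cpNorm p (bellman Amb r α v - bellman Amb r α w) ≤ α * C_P * cpNorm p (v - w) := by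
  have hα := H.α_pos
  have hC := zero_le_one.trans H.one_le_C_P
  refine cpNorm_le (mul_nonneg (by positivity) (cpNorm_nonneg _)) fun x => abs_le.2 ?_
  have h1 := H.bellman_le_add hv hw x
  have h2 := H.bellman_le_add hw hv x
  rw [cpNorm_sub_comm w v] at h2
  simp only [Pi.sub_apply]
  constructor <;> linarith

/-- There is a measurable choice of maximizing actions: it minimizes `-worstStep` over the constant
correspondence with value `A`, and the coordinates of `A` determine measurability. -/
theorem exists_locAction_eq_bellman [CompactSpace A] (hv : MemCp p v) :
    ∃ a : LocAction S A, ∀ x, worstStep Amb r α v x (a.1 x) = bellman Amb r α v x := by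
  have hup : UpperHemicontinuous fun _ : S => (Set.univ : Set A) :=
    upperHemicontinuous_iff_forall_isOpen.2 fun _ _ _ h => Eventually.of_forall fun _ => h
  have hlow : LowerHemicontinuous fun _ : S => (Set.univ : Set A) :=
    lowerHemicontinuous_iff_isOpen_inter_nonempty.2 fun _ _ => isOpen_const
  have hcoord : ∀ i : Fin m, Continuous fun a : A => (a : EuclideanSpace ℝ (Fin m)) i :=
    fun i => by fun_prop
  obtain ⟨a, ha, ham⟩ := exists_selection_isMin hup hlow (fun _ => isCompact_univ)
    (fun _ => Set.univ_nonempty) (f := fun z : S × A => -worstStep Amb r α v z.1 z.2)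
    (H.continuous_worstStep hv).neg
    (fun n a => if h : n < m then (a : EuclideanSpace ℝ (Fin m)) ⟨n, h⟩ else 0) (fun n => by
      by_cases h : n < m
      · simpa [h] using hcoord ⟨n, h⟩
      · simpa [h] using continuous_const)
  have hmeas : Measurable a := by
    refine measurable_comap_iff.2 ?_
    have h : Measurable fun x => WithLp.ofLp (a x : EuclideanSpace ℝ (Fin m)) :=
      measurable_pi_iff.2 fun i => by simpa using ham i
    exact (WithLp.measurable_toLp 2 (Fin m → ℝ)).comp h
  refine ⟨⟨a, hmeas⟩, fun x => le_antisymm (H.worstStep_le_bellman hv x _) (ciSup_le fun b => ?_)⟩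
  have hbdd : BddBelow (Set.range fun y : (Set.univ : Set A) => -worstStep Amb r α v x y) := by
    refine ⟨-bellman Amb r α v x, ?_⟩
    rintro _ ⟨b, rfl⟩
    exact neg_le_neg (H.worstStep_le_bellman hv x _)
  have h1 := ciInf_le hbdd ⟨b, trivial⟩
  rw [← (ha x).2] at h1
  exact neg_le_neg_iff.1 h1

end Assumptions

end Model

end RobustMDP

/-! ### Almost sure convergence of series with summable first moments -/

theorem MeasureTheory.ae_summable_and_integrable_tsum {Ω : Type*} [MeasurableSpace Ω]
    {μ : Measure Ω} {F : ℕ → Ω → ℝ} (hF : ∀ i, Integrable (F i) μ)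
    (hsum : Summable fun i => ∫ ω, ‖F i ω‖ ∂μ) :
    (∀ᵐ ω ∂μ, Summable fun i => F i ω) ∧ Integrable (fun ω => ∑' i, F i ω) μ := by
  have hfin : ∑' i, ∫⁻ ω, ‖F i ω‖ₑ ∂μ ≠ ∞ := by
    simp_rw [← fun i => ofReal_integral_norm_eq_lintegral_enorm (hF i)]
    exact hsum.tsum_ofReal_ne_top
  have hs : ∀ᵐ ω ∂μ, Summable fun i => F i ω := by
    have := summable_norm_of_tsum_eLpNorm_ne_top le_rfl (fun i => (hF i).1)
      (by simpa only [eLpNorm_one_eq_lintegral_enorm] using hfin)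
    filter_upwards [this] with ω hω using hω.of_norm
  refine ⟨hs, ?_, ?_⟩
  · refine aestronglyMeasurable_of_tendsto_ae atTop
      (f := fun n ω => ∑ i ∈ Finset.range n, F i ω) (fun n => ?_) ?_
    · exact (integrable_finsetSum _ fun i _ => hF i).1
    · filter_upwards [hs] with ω hω using hω.hasSum.tendsto_sum_nat
  · calc ∫⁻ ω, ‖∑' i, F i ω‖ₑ ∂μ ≤ ∫⁻ ω, ∑' i, ‖F i ω‖ₑ ∂μ :=
          lintegral_mono fun ω => enorm_tsum_le_tsum_enorm
      _ = ∑' i, ∫⁻ ω, ‖F i ω‖ₑ ∂μ := lintegral_tsum fun i => (hF i).1.enorm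
      _ < ∞ := hfin.lt_top

namespace RobustMDP

/-! ### The canonical process under a path measure -/

section Paths

variable {d p : ℕ} {S : Set (EuclideanSpace ℝ (Fin d))}

instance (x : S) (κ : ℕ → TransKernel p S) : IsProbabilityMeasure (pathMeasure x κ) :=
  inferInstanceAs (IsProbabilityMeasure (Kernel.trajMeasure _ _))

theorem map_zero_pathMeasure (x : S) (κ : ℕ → TransKernel p S) :
    (pathMeasure x κ).map (fun ω => ω 0) = Measure.dirac x := by
  have h : (fun ω : ℕ → S => ω 0) =
      (fun h : ∀ _ : Finset.Iic 0, S => h ⟨0, Finset.mem_Iic.2 le_rfl⟩) ∘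
        Preorder.frestrictLe 0 := rfl
  rw [h, ← Measure.map_map (by fun_prop) (by fun_prop), pathMeasure, Kernel.trajMeasure,
    Measure.map_comp _ _ (by fun_prop), Kernel.traj_map_frestrictLe, Kernel.partialTraj_self,
    Measure.id_comp, Measure.map_map (by fun_prop) (by fun_prop)]
  exact Measure.map_dirac' (by fun_prop) x

/-- The Markov property of the canonical process: the joint law of `(X_t, X_{t+1})`. -/
theorem map_pair_pathMeasure (x : S) (κ : ℕ → TransKernel p S) (t : ℕ) :
    (pathMeasure x κ).map (fun ω => (ω t, ω (t + 1))) =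
      ((pathMeasure x κ).map fun ω => ω t) ⊗ₘ (κ t).toKernel := by
  have h := Kernel.map_frestrictLe_trajMeasure_compProd_eq_map_trajMeasure (X := fun _ => S)
    (μ₀ := Measure.dirac x) (κ := fun t => (κ t).onHistory t) (a := t)
  rw [show Kernel.trajMeasure (X := fun _ => S) (Measure.dirac x) (fun t => (κ t).onHistory t) =
    pathMeasure x κ from rfl] at h
  let e : (∀ _ : Finset.Iic t, S) → S := fun h => h ⟨t, Finset.mem_Iic.2 le_rfl⟩
  have he : Measurable e := measurable_pi_apply _
  have h1 : (fun ω : ℕ → S => (ω t, ω (t + 1))) =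
      Prod.map e id ∘ fun ω => (Preorder.frestrictLe t ω, ω (t + 1)) := rfl
  have h2 : (fun ω : ℕ → S => ω t) = e ∘ Preorder.frestrictLe t := rfl
  rw [h1, h2, ← Measure.map_map (by fun_prop) (by fun_prop), ← h,
    ← Measure.map_map he (by fun_prop)]
  refine Measure.ext_of_lintegral _ fun f hf => ?_
  rw [lintegral_map hf (by fun_prop), Measure.lintegral_compProd (by fun_prop),
    Measure.lintegral_compProd hf, lintegral_map (by fun_prop) he]
  rfl

theorem integral_zero_pathMeasure (x : S) (κ : ℕ → TransKernel p S) {g : S → ℝ}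
    (hg : Measurable g) : ∫ ω, g (ω 0) ∂pathMeasure x κ = g x := by
  have := integral_map (μ := pathMeasure x κ) (φ := fun ω => ω 0)
    (measurable_pi_apply 0).aemeasurable
    (f := g) hg.aestronglyMeasurable
  rw [← this, map_zero_pathMeasure, integral_dirac' _ _ hg.stronglyMeasurable]

theorem integral_pair_pathMeasure (x : S) (κ : ℕ → TransKernel p S) (t : ℕ) {h : S × S → ℝ}
    (hm : Measurable h) (hi : Integrable (fun ω => h (ω t, ω (t + 1))) (pathMeasure x κ)) :
    ∫ ω, h (ω t, ω (t + 1)) ∂pathMeasure x κ =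
      ∫ ω, ∫ y, h (ω t, y) ∂((κ t).1 (ω t)).toMeasure ∂pathMeasure x κ := by
  have hφ : Measurable fun ω : ℕ → S => (ω t, ω (t + 1)) := by fun_prop
  have h1 := integral_map (μ := pathMeasure x κ) hφ.aemeasurable hm.aestronglyMeasurable
  have h2 : Integrable h ((pathMeasure x κ).map fun ω => (ω t, ω (t + 1))) :=
    (integrable_map_measure hm.aestronglyMeasurable hφ.aemeasurable).2 hi
  rw [map_pair_pathMeasure] at h1 h2
  rw [← h1, Measure.integral_compProd h2, integral_map (measurable_pi_apply t).aemeasurable]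
  · rfl
  · exact hm.stronglyMeasurable.integral_kernel_prod_right'.aestronglyMeasurable

variable {m : ℕ} {A : Set (EuclideanSpace ℝ (Fin m))}

namespace Assumptions

variable {Amb : S × A → Set (MomentMeasure p S)} {r : S → A → S → ℝ} {α C_P C_r : ℝ}
  (H : Assumptions Amb r α C_P C_r) {v : S → ℝ} {a : Policy S A} {κ : ℕ → TransKernel p S}
  (hκ : ∀ t y, (κ t).1 y ∈ Amb (y, (a t).1 y)) (x : S)

include H

theorem C_P_nonneg : 0 ≤ C_P := zero_le_one.trans H.one_le_C_P

include hκ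

/-- The growth condition, iterated along the Markov chain. -/
theorem integrable_weight_and_integral_le (t : ℕ) :
    Integrable (fun ω => weight p (ω t)) (pathMeasure x κ) ∧
      ∫ ω, weight p (ω t) ∂pathMeasure x κ ≤ C_P ^ t * weight p x := by
  have hwm : Measurable (weight p : S → ℝ) := continuous_weight.measurable
  induction t with
  | zero =>
    refine ⟨?_, ?_⟩
    · have : Integrable (weight p) ((pathMeasure x κ).map fun ω => ω 0) := by
        rw [map_zero_pathMeasure]
        exact integrable_dirac' hwm.stronglyMeasurable (by simp)
      exact this.comp_measurable (measurable_pi_apply 0)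
    · rw [integral_zero_pathMeasure x κ hwm, pow_zero, one_mul]
  | succ t ih =>
    have hm : Measurable fun q : S × S => weight p q.2 := hwm.comp measurable_snd
    have hle : ∀ y : S, ∫ z, weight p z ∂((κ t).1 y).toMeasure ≤ C_P * weight p y :=
      fun y => H.growth y _ _ (hκ t y)
    have hnn : ∀ y : S, 0 ≤ ∫ z, weight p z ∂((κ t).1 y).toMeasure :=
      fun y => integral_nonneg fun z => (weight_pos z).le
    have hkm : StronglyMeasurable fun y : S => ∫ z, weight p z ∂((κ t).1 y).toMeasure :=
      hm.stronglyMeasurable.integral_kernel_prod_right' (κ := (κ t).toKernel)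
    have hki : Integrable (fun ω => ∫ z, weight p z ∂((κ t).1 (ω t)).toMeasure)
        (pathMeasure x κ) := by
      refine (ih.1.const_mul C_P).mono'
        (hkm.comp_measurable (measurable_pi_apply t)).aestronglyMeasurable
        (ae_of_all _ fun ω => ?_)
      rw [Real.norm_eq_abs, abs_of_nonneg (hnn _)]
      exact hle _
    have hint : Integrable (fun ω => weight p (ω (t + 1))) (pathMeasure x κ) := by
      have : Integrable (fun q : S × S => weight p q.2)
          ((pathMeasure x κ).map fun ω => (ω t, ω (t + 1))) := by
        rw [map_pair_pathMeasure, Measure.integrable_compProd_iff hm.aestronglyMeasurable]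
        refine ⟨ae_of_all _ fun y => ((κ t).1 y).integrable_weight, ?_⟩
        simp_rw [Real.norm_eq_abs, abs_of_pos (weight_pos _)]
        exact (integrable_map_measure hkm.aestronglyMeasurable
          (measurable_pi_apply t).aemeasurable).2 hki
      exact this.comp_measurable (by fun_prop : Measurable fun ω : ℕ → S => (ω t, ω (t + 1)))
    refine ⟨hint, ?_⟩
    calc ∫ ω, weight p (ω (t + 1)) ∂pathMeasure x κ
        = ∫ ω, ∫ z, weight p z ∂((κ t).1 (ω t)).toMeasure ∂pathMeasure x κ :=
          integral_pair_pathMeasure x κ t hm hint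
      _ ≤ ∫ ω, C_P * weight p (ω t) ∂pathMeasure x κ :=
          integral_mono hki (ih.1.const_mul C_P) fun ω => hle (ω t)
      _ = C_P * ∫ ω, weight p (ω t) ∂pathMeasure x κ := integral_const_mul _ _
      _ ≤ C_P * (C_P ^ t * weight p x) := mul_le_mul_of_nonneg_left ih.2 H.C_P_nonneg
      _ = C_P ^ (t + 1) * weight p x := by ring

theorem integrable_state (hv : MemCp p v) (t : ℕ) :
    Integrable (fun ω => v (ω t)) (pathMeasure x κ) ∧
      |∫ ω, v (ω t) ∂pathMeasure x κ| ≤ cpNorm p v * weight p x * C_P ^ t := by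
  obtain ⟨hi, hle⟩ := H.integrable_weight_and_integral_le hκ x t
  have hi' := hi.const_mul (cpNorm p v)
  refine ⟨hi'.mono' (hv.1.measurable.comp (measurable_pi_apply t)).aestronglyMeasurable
    (ae_of_all _ fun ω => hv.abs_le _), ?_⟩
  calc |∫ ω, v (ω t) ∂pathMeasure x κ|
      ≤ ∫ ω, cpNorm p v * weight p (ω t) ∂pathMeasure x κ :=
        abs_integral_le hi' fun ω => hv.abs_le _
    _ = cpNorm p v * ∫ ω, weight p (ω t) ∂pathMeasure x κ := integral_const_mul _ _
    _ ≤ cpNorm p v * (C_P ^ t * weight p x) :=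
        mul_le_mul_of_nonneg_left hle (cpNorm_nonneg v)
    _ = _ := by ring

omit hκ in
theorem measurable_reward (b : LocAction S A) : Measurable fun q : S × S => r q.1 (b.1 q.1) q.2 :=
  H.continuous_reward.measurable.comp
    (measurable_fst.prodMk ((b.2.comp measurable_fst).prodMk measurable_snd))

theorem integrable_reward (t : ℕ) :
    Integrable (fun ω => r (ω t) ((a t).1 (ω t)) (ω (t + 1))) (pathMeasure x κ) ∧
      ∫ ω, |r (ω t) ((a t).1 (ω t)) (ω (t + 1))| ∂pathMeasure x κ ≤
        C_r * (1 + C_P) * weight p x * C_P ^ t := by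
  have hCr := zero_le_one.trans H.one_le_C_r
  obtain ⟨hi, hle⟩ := H.integrable_weight_and_integral_le hκ x t
  obtain ⟨hi', hle'⟩ := H.integrable_weight_and_integral_le hκ x (t + 1)
  have hib := (hi.add hi').const_mul C_r
  have hint : Integrable (fun ω => r (ω t) ((a t).1 (ω t)) (ω (t + 1))) (pathMeasure x κ) :=
    hib.mono' ((H.measurable_reward (a t)).comp
      (by fun_prop : Measurable fun ω : ℕ → S => (ω t, ω (t + 1)))).aestronglyMeasurable
      (ae_of_all _ fun ω => H.reward_growth _ _ _)
  refine ⟨hint, ?_⟩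
  calc ∫ ω, |r (ω t) ((a t).1 (ω t)) (ω (t + 1))| ∂pathMeasure x κ
      ≤ ∫ ω, C_r * (weight p (ω t) + weight p (ω (t + 1))) ∂pathMeasure x κ :=
        integral_mono hint.abs hib fun ω => H.reward_growth _ _ _
    _ = C_r * (∫ ω, weight p (ω t) ∂pathMeasure x κ
          + ∫ ω, weight p (ω (t + 1)) ∂pathMeasure x κ) := by
        rw [integral_const_mul, integral_add hi hi']
    _ ≤ C_r * (C_P ^ t * weight p x + C_P ^ (t + 1) * weight p x) := by gcongr
    _ = _ := by ring

omit hκ in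
theorem summable_discount (c : ℝ) : Summable fun t : ℕ => c * (α * C_P) ^ t :=
  (summable_geometric_of_lt_one (mul_nonneg H.α_pos.le H.C_P_nonneg) H.α_mul_lt_one).mul_left c

theorem integral_norm_discounted_le (t : ℕ) :
    ∫ ω, ‖α ^ t * r (ω t) ((a t).1 (ω t)) (ω (t + 1))‖ ∂pathMeasure x κ ≤
      C_r * (1 + C_P) * weight p x * (α * C_P) ^ t := by
  have hα := H.α_pos
  calc ∫ ω, ‖α ^ t * r (ω t) ((a t).1 (ω t)) (ω (t + 1))‖ ∂pathMeasure x κ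
      = α ^ t * ∫ ω, |r (ω t) ((a t).1 (ω t)) (ω (t + 1))| ∂pathMeasure x κ := by
        simp_rw [Real.norm_eq_abs, abs_mul, abs_of_pos (pow_pos hα t)]
        exact integral_const_mul _ _
    _ ≤ α ^ t * (C_r * (1 + C_P) * weight p x * C_P ^ t) :=
        mul_le_mul_of_nonneg_left (H.integrable_reward hκ x t).2 (pow_pos hα t).le
    _ = _ := by rw [mul_pow]; ring

theorem summable_integral_norm :
    Summable fun t => ∫ ω, ‖α ^ t * r (ω t) ((a t).1 (ω t)) (ω (t + 1))‖ ∂pathMeasure x κ :=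
  (H.summable_discount _).of_nonneg_of_le (fun _ => integral_nonneg fun _ => norm_nonneg _)
    (H.integral_norm_discounted_le hκ x)

theorem ae_summable_and_integrable_totalReward :
    (∀ᵐ ω ∂pathMeasure x κ, Summable fun t : ℕ => α ^ t * r (ω t) ((a t).1 (ω t)) (ω (t + 1))) ∧
      Integrable (totalReward r α a) (pathMeasure x κ) :=
  ae_summable_and_integrable_tsum (fun t => (H.integrable_reward hκ x t).1.const_mul _)
    (H.summable_integral_norm hκ x)

theorem hasSum_integral_totalReward :
    HasSum (fun t => ∫ ω, α ^ t * r (ω t) ((a t).1 (ω t)) (ω (t + 1)) ∂pathMeasure x κ)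
      (∫ ω, totalReward r α a ω ∂pathMeasure x κ) :=
  hasSum_integral_of_summable_integral_norm
    (fun t => (H.integrable_reward hκ x t).1.const_mul _) (H.summable_integral_norm hκ x)

theorem abs_integral_totalReward_le :
    |∫ ω, totalReward r α a ω ∂pathMeasure x κ| ≤
      ∑' t : ℕ, C_r * (1 + C_P) * weight p x * (α * C_P) ^ t := by
  rw [← (H.hasSum_integral_totalReward hκ x).tsum_eq]
  exact tsum_of_norm_bounded (H.summable_discount _).hasSum fun t =>
    (norm_integral_le_integral_norm _).trans (H.integral_norm_discounted_le hκ x t)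

/-- The gap between the expected total reward and `v x` is the discounted sum of the expected
one-step gaps: the terms `α ^ t * E[v(X_t)]` telescope. -/
theorem hasSum_oneStep_sub (hv : MemCp p v) :
    HasSum (fun t => α ^ t * ∫ ω,
        (oneStep r α v (ω t) ((a t).1 (ω t)) ((κ t).1 (ω t)) - v (ω t)) ∂pathMeasure x κ)
      (∫ ω, totalReward r α a ω ∂pathMeasure x κ - v x) := by
  let E : ℕ → ℝ := fun t => α ^ t * ∫ ω, v (ω t) ∂pathMeasure x κ
  have hE : Summable E := by
    refine (H.summable_discount (cpNorm p v * weight p x)).of_norm_bounded fun t => ?_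
    rw [Real.norm_eq_abs, abs_mul, abs_of_pos (pow_pos H.α_pos t), mul_pow, mul_left_comm]
    exact mul_le_mul_of_nonneg_left (H.integrable_state hκ x hv t).2 (pow_pos H.α_pos t).le
  have hE0 : E 0 = v x := by
    simp [E, integral_zero_pathMeasure x κ hv.1.measurable]
  have hshift : HasSum (fun t => E (t + 1)) (∑' t, E t - v x) := by
    have := (hasSum_nat_add_iff' 1).2 hE.hasSum
    simpa [hE0] using this
  have hsum := (H.hasSum_integral_totalReward hκ x).add (hshift.sub hE.hasSum)
  convert hsum using 1
  · funext t
    have hr := (H.integrable_reward hκ x t).1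
    have hv1 := (H.integrable_state hκ x hv t).1
    have hv2 := ((H.integrable_state hκ x hv (t + 1)).1).const_mul α
    have hrm := H.measurable_reward (a t)
    have hvm := hv.1.measurable
    have hkey := integral_pair_pathMeasure x κ t
      (h := fun q => r q.1 ((a t).1 q.1) q.2 + α * v q.2 - v q.1)
      ((hrm.add ((hvm.comp measurable_snd).const_mul α)).sub (hvm.comp measurable_fst))
      ((hr.add hv2).sub hv1)
    have hinner : ∀ y : S, ∫ z, (r y ((a t).1 y) z + α * v z - v y) ∂((κ t).1 y).toMeasure =
        oneStep r α v y ((a t).1 y) ((κ t).1 y) - v y := fun y => by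
      rw [integral_sub (((κ t).1 y).integrable (H.memCp_integrand hv y _)) (integrable_const _),
        integral_const]
      simp [oneStep]
    simp only [hinner] at hkey
    have hsub : ∫ ω, (r (ω t) ((a t).1 (ω t)) (ω (t + 1)) + α * v (ω (t + 1)) - v (ω t))
          ∂pathMeasure x κ =
        ∫ ω, (r (ω t) ((a t).1 (ω t)) (ω (t + 1)) + α * v (ω (t + 1))) ∂pathMeasure x κ -
          ∫ ω, v (ω t) ∂pathMeasure x κ := integral_sub (hr.add hv2) hv1
    rw [← hkey, hsub, integral_add hr hv2, integral_const_mul, integral_const_mul]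
    simp only [E]
    ring
  · ring

theorem le_integral_totalReward (hv : MemCp p v)
    (h : ∀ t y, v y ≤ oneStep r α v y ((a t).1 y) ((κ t).1 y)) :
    v x ≤ ∫ ω, totalReward r α a ω ∂pathMeasure x κ :=
  sub_nonneg.1 <| (H.hasSum_oneStep_sub hκ x hv).nonneg fun t =>
    mul_nonneg (pow_pos H.α_pos t).le (integral_nonneg fun _ => sub_nonneg.2 (h t _))

theorem integral_totalReward_le (hv : MemCp p v)
    (h : ∀ t y, oneStep r α v y ((a t).1 y) ((κ t).1 y) ≤ v y) :
    ∫ ω, totalReward r α a ω ∂pathMeasure x κ ≤ v x :=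
  sub_nonpos.1 <| (H.hasSum_oneStep_sub hκ x hv).nonpos fun t =>
    mul_nonpos_of_nonneg_of_nonpos (pow_pos H.α_pos t).le
      (integral_nonpos fun _ => sub_nonpos.2 (h t _))

end Assumptions

end Paths

section Solution

variable {d m p : ℕ} {S : Set (EuclideanSpace ℝ (Fin d))} {A : Set (EuclideanSpace ℝ (Fin m))}

/-! ### The fixed point of the Bellman operator -/

/-- The element `g / weight` of the Banach space of bounded continuous functions. -/
noncomputable def MemCp.toBCF {g : S → ℝ} (hg : MemCp p g) : BoundedContinuousFunction S ℝ :=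
  BoundedContinuousFunction.ofNormedAddCommGroup (fun x => g x / weight p x)
    (hg.1.div₀ continuous_weight fun x => (weight_pos x).ne') (cpNorm p g) fun x => by
      rw [norm_div, Real.norm_eq_abs, Real.norm_eq_abs, abs_of_pos (weight_pos x)]
      exact (div_le_iff₀ (weight_pos x)).2 (hg.abs_le x)

theorem MemCp.dist_toBCF_le {g h : S → ℝ} (hg : MemCp p g) (hh : MemCp p h) :
    dist hg.toBCF hh.toBCF ≤ cpNorm p (g - h) := by
  refine (BoundedContinuousFunction.dist_le (cpNorm_nonneg _)).2 fun x => ?_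
  change |g x / weight p x - h x / weight p x| ≤ _
  rw [← sub_div, abs_div, abs_of_pos (weight_pos x)]
  exact (div_le_iff₀ (weight_pos x)).2 ((hg.sub hh).abs_le x)

theorem memCp_mul_weight (u : BoundedContinuousFunction S ℝ) :
    MemCp p fun x => u x * weight p x :=
  memCp_of_abs_le (C := ‖u‖) (u.continuous.mul continuous_weight) fun x => by
    rw [abs_mul, abs_of_pos (weight_pos x)]
    exact mul_le_mul_of_nonneg_right (u.norm_coe_le_norm x) (weight_pos x).le

theorem cpNorm_mul_weight_sub_le (u w : BoundedContinuousFunction S ℝ) :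
    cpNorm p ((fun x => u x * weight p x) - fun x => w x * weight p x) ≤ dist u w :=
  cpNorm_le dist_nonneg fun x => by
    rw [Pi.sub_apply, ← sub_mul, abs_mul, abs_of_pos (weight_pos x)]
    have h : |u x - w x| ≤ dist u w :=
      BoundedContinuousFunction.dist_coe_le_dist (f := u) (g := w) x
    exact mul_le_mul_of_nonneg_right h (weight_pos x).le

theorem memCp_zero : MemCp p (0 : S → ℝ) :=
  memCp_of_abs_le (C := 0) continuous_const fun x => by simp

namespace Assumptions

variable {Amb : S × A → Set (MomentMeasure p S)} {r : S → A → S → ℝ} {α C_P C_r : ℝ}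
  (H : Assumptions Amb r α C_P C_r) {v w : S → ℝ}

include H

theorem α_mul_nonneg : 0 ≤ α * C_P := mul_nonneg H.α_pos.le H.C_P_nonneg

theorem exists_bellman_eq [CompactSpace A] [Nonempty A] :
    ∃ v : S → ℝ, MemCp p v ∧ bellman Amb r α v = v := by
  let Φ : BoundedContinuousFunction S ℝ → BoundedContinuousFunction S ℝ :=
    fun u => (H.memCp_bellman (memCp_mul_weight u)).toBCF
  have hΦ : ContractingWith ⟨α * C_P, H.α_mul_nonneg⟩ Φ := by
    refine ⟨NNReal.coe_lt_coe.1 H.α_mul_lt_one, LipschitzWith.of_dist_le_mul fun u w => ?_⟩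
    refine (MemCp.dist_toBCF_le _ _).trans ((H.cpNorm_bellman_sub_le (memCp_mul_weight u)
      (memCp_mul_weight w)).trans ?_)
    exact mul_le_mul_of_nonneg_left (cpNorm_mul_weight_sub_le u w) H.α_mul_nonneg
  let u := ContractingWith.fixedPoint Φ hΦ
  have hu : Φ u = u := hΦ.fixedPoint_isFixedPt
  refine ⟨fun x => u x * weight p x, memCp_mul_weight u, funext fun x => ?_⟩
  have hx : bellman Amb r α (fun x => u x * weight p x) x / weight p x = u x :=
    DFunLike.congr_fun hu x
  exact (div_eq_iff (weight_pos x).ne').1 hx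

variable [Nonempty A]

theorem bellman_fixedPoint_unique (hv : MemCp p v) (hw : MemCp p w)
    (hTv : bellman Amb r α v = v) (hTw : bellman Amb r α w = w) : v = w := by
  have h := H.cpNorm_bellman_sub_le hv hw
  rw [hTv, hTw] at h
  have h0 : cpNorm p (v - w) = 0 := by
    nlinarith [cpNorm_nonneg (p := p) (v - w), H.α_mul_lt_one]
  funext x
  have hx := (hv.sub hw).abs_le x
  rw [h0, zero_mul] at hx
  exact sub_eq_zero.1 (abs_nonpos_iff.1 hx)

theorem tendsto_iterate_bellman [CompactSpace A] (hv : MemCp p v)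
    (hTv : bellman Amb r α v = v) (hw : MemCp p w) :
    Tendsto (fun n : ℕ => cpNorm p ((bellman Amb r α)^[n] w - v)) atTop (𝓝 0) := by
  have hmem : ∀ n : ℕ, MemCp p ((bellman Amb r α)^[n] w) ∧
      cpNorm p ((bellman Amb r α)^[n] w - v) ≤ (α * C_P) ^ n * cpNorm p (w - v) := by
    intro n
    induction n with
    | zero => exact ⟨hw, by simp⟩
    | succ n ih =>
      rw [Function.iterate_succ_apply']
      refine ⟨H.memCp_bellman ih.1, ?_⟩
      calc cpNorm p (bellman Amb r α ((bellman Amb r α)^[n] w) - v)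
          = cpNorm p (bellman Amb r α ((bellman Amb r α)^[n] w) - bellman Amb r α v) := by
            rw [hTv]
        _ ≤ α * C_P * cpNorm p ((bellman Amb r α)^[n] w - v) :=
            H.cpNorm_bellman_sub_le ih.1 hv
        _ ≤ α * C_P * ((α * C_P) ^ n * cpNorm p (w - v)) :=
            mul_le_mul_of_nonneg_left ih.2 H.α_mul_nonneg
        _ = _ := by ring
  refine squeeze_zero (fun n => cpNorm_nonneg _) (fun n => (hmem n).2) ?_
  simpa using (tendsto_pow_atTop_nhds_zero_of_lt_one H.α_mul_nonneg
    H.α_mul_lt_one).mul_const (cpNorm p (w - v))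

/-! ### One-step optimality -/

omit H in
theorem nonempty_locAction : Nonempty (LocAction S A) :=
  ⟨⟨fun _ => Classical.arbitrary A, measurable_const⟩⟩

/-- Maximizing over measurable action maps is the same as maximizing over actions pointwise, since
the pointwise maximum is attained by a measurable map. -/
theorem iSup_locAction_worstStep [CompactSpace A] (hv : MemCp p v) (x : S) :
    (⨆ b : LocAction S A, worstStep Amb r α v x (b.1 x)) = bellman Amb r α v x := by
  have := nonempty_locAction (S := S) (A := A)
  obtain ⟨a, ha⟩ := H.exists_locAction_eq_bellman hv
  refine le_antisymm (ciSup_le fun b => H.worstStep_le_bellman hv x _) ?_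
  rw [← ha x]
  exact le_ciSup (f := fun b : LocAction S A => worstStep Amb r α v x (b.1 x))
    ⟨bellman Amb r α v x, by rintro _ ⟨b, rfl⟩; exact H.worstStep_le_bellman hv x _⟩ a

omit H [Nonempty A] in
theorem _root_.RobustMDP.IsWorstKernel.locKernel_mem {P₀ : S × A → MomentMeasure p S}
    (hP₀ : IsWorstKernel Amb r α v P₀) (a : LocAction S A) :
    locKernel P₀ hP₀.1 a ∈ locKernels Amb a :=
  fun x => (hP₀.2 x (a.1 x)).1

omit [Nonempty A] in
/-- Minimizing over kernels is the same as minimizing pointwise, since the pointwise minimum is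
attained by a measurable selector. -/
theorem iInf_locKernels_oneStep (hv : MemCp p v) (b : LocAction S A) (x : S) :
    (⨅ κ : locKernels Amb b, oneStep r α v x (b.1 x) (κ.1.1 x)) =
      worstStep Amb r α v x (b.1 x) := by
  obtain ⟨P₀, hP₀⟩ := H.exists_isWorstKernel hv
  let κ₀ : locKernels Amb b := ⟨locKernel P₀ hP₀.1 b, hP₀.locKernel_mem b⟩
  have : Nonempty (locKernels Amb b) := ⟨κ₀⟩
  refine le_antisymm ?_ (le_ciInf fun κ => H.worstStep_le hv (κ.2 x))
  rw [← (hP₀.2 x (b.1 x)).2]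
  exact ciInf_le (f := fun κ : locKernels Amb b => oneStep r α v x (b.1 x) (κ.1.1 x))
    ⟨_, by rintro _ ⟨κ, rfl⟩; exact H.worstStep_le hv (κ.2 x)⟩ κ₀

/-! ### The value of the infinite-horizon problem -/

omit H [Nonempty A] in
theorem _root_.RobustMDP.IsWorstKernel.pathMeasure_mem {P₀ : S × A → MomentMeasure p S}
    (hP₀ : IsWorstKernel Amb r α v P₀) (x : S) (a : Policy S A) :
    pathMeasure x (fun t => locKernel P₀ hP₀.1 (a t)) ∈ admissible Amb x a :=
  ⟨_, fun t => hP₀.locKernel_mem (a t), rfl⟩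

omit [Nonempty A] in
theorem admissible_nonempty (x : S) (a : Policy S A) : (admissible Amb x a).Nonempty := by
  obtain ⟨P₀, hP₀⟩ := H.exists_isWorstKernel memCp_zero
  exact ⟨_, hP₀.pathMeasure_mem x a⟩

omit [Nonempty A] in
theorem bddBelow_integral_totalReward (x : S) (a : Policy S A) :
    BddBelow (Set.range fun μ : admissible Amb x a =>
      ∫ ω, totalReward r α a ω ∂(μ : Measure (ℕ → S))) := by
  refine ⟨-∑' t : ℕ, C_r * (1 + C_P) * weight p x * (α * C_P) ^ t, ?_⟩
  rintro _ ⟨⟨_, κ, hκ, rfl⟩, rfl⟩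
  exact (abs_le.1 (H.abs_integral_totalReward_le hκ x)).1

omit [Nonempty A] in
theorem worstCase_le {x : S} {a : Policy S A} {μ : Measure (ℕ → S)}
    (hμ : μ ∈ admissible Amb x a) : worstCase Amb r α x a ≤ ∫ ω, totalReward r α a ω ∂μ :=
  ciInf_le (H.bddBelow_integral_totalReward x a) ⟨μ, hμ⟩

omit [Nonempty A] in
theorem bddAbove_worstCase (x : S) :
    BddAbove (Set.range fun a : Policy S A => worstCase Amb r α x a) := by
  refine ⟨∑' t : ℕ, C_r * (1 + C_P) * weight p x * (α * C_P) ^ t, ?_⟩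
  rintro _ ⟨a, rfl⟩
  obtain ⟨μ, κ, hκ, rfl⟩ := H.admissible_nonempty x a
  exact (H.worstCase_le ⟨κ, hκ, rfl⟩).trans (abs_le.1 (H.abs_integral_totalReward_le hκ x)).2

section Verification

variable (hv : MemCp p v) (hTv : bellman Amb r α v = v) {P₀ : S × A → MomentMeasure p S}
  (hP₀ : IsWorstKernel Amb r α v P₀)

include hv hTv

omit [Nonempty A] in
include hP₀ in
/-- Against any control, nature keeps the expected total reward below `v x` by using the kernels
that are worst for the one-step problem with continuation value `v`. -/
theorem worstCase_le_fixedPoint (x : S) (a : Policy S A) : worstCase Amb r α x a ≤ v x := by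
  refine (H.worstCase_le (hP₀.pathMeasure_mem x a)).trans
    (H.integral_totalReward_le (fun t => hP₀.locKernel_mem (a t)) x hv fun t y => ?_)
  calc oneStep r α v y ((a t).1 y) (P₀ (y, (a t).1 y))
      = worstStep Amb r α v y ((a t).1 y) := (hP₀.2 y _).2
    _ ≤ bellman Amb r α v y := H.worstStep_le_bellman hv y _
    _ = v y := congrFun hTv y

variable {a : LocAction S A} (ha : ∀ x, worstStep Amb r α v x (a.1 x) = bellman Amb r α v x)

include ha

omit [Nonempty A] in
/-- Against any admissible kernels, an action that is optimal for the one-step problem guarantees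
`v x`. -/
theorem fixedPoint_le_worstCase (x : S) : v x ≤ worstCase Amb r α x fun _ => a := by
  have := (H.admissible_nonempty x fun _ => a).to_subtype
  refine le_ciInf ?_
  rintro ⟨_, κ, hκ, rfl⟩
  refine H.le_integral_totalReward hκ x hv fun t y => ?_
  calc v y = worstStep Amb r α v y (a.1 y) := by rw [ha y, hTv]
    _ ≤ oneStep r α v y (a.1 y) ((κ t).1 y) := H.worstStep_le hv (hκ t y)

include hP₀

omit [Nonempty A] in
theorem worstCase_eq_fixedPoint (x : S) : (worstCase Amb r α x fun _ => a) = v x :=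
  (H.worstCase_le_fixedPoint hv hTv hP₀ x _).antisymm (H.fixedPoint_le_worstCase hv hTv ha x)

omit [Nonempty A] in
theorem integral_totalReward_eq_fixedPoint (x : S) :
    ∫ ω, totalReward r α (fun _ => a) ω ∂pathMeasure x (fun _ => locKernel P₀ hP₀.1 a) = v x := by
  have hκ : ∀ (t : ℕ) y, (locKernel P₀ hP₀.1 a).1 y ∈ Amb (y, a.1 y) :=
    fun t => hP₀.locKernel_mem a
  refine le_antisymm (H.integral_totalReward_le (a := fun _ => a) hκ x hv fun t y => ?_)
    ((H.fixedPoint_le_worstCase hv hTv ha x).trans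
      (H.worstCase_le (hP₀.pathMeasure_mem x fun _ => a)))
  calc oneStep r α v y (a.1 y) (P₀ (y, a.1 y)) = worstStep Amb r α v y (a.1 y) := (hP₀.2 y _).2
    _ = v y := by rw [ha y, hTv]
    _ ≤ v y := le_rfl

theorem value_eq_fixedPoint (x : S) : value Amb r α x = v x := by
  have := nonempty_locAction (S := S) (A := A)
  refine le_antisymm (ciSup_le fun b => H.worstCase_le_fixedPoint hv hTv hP₀ x b) ?_
  rw [← H.worstCase_eq_fixedPoint hv hTv hP₀ ha x]
  exact le_ciSup (H.bddAbove_worstCase x) fun _ => a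

end Verification

end Assumptions

end Solution

/-! ### The modulus of continuity of the reward -/

/-- The moduli `ρ₀` and `ρA` may be infinite away from `0`, hence the equicontinuity is only
local. -/
theorem reward_equicontinuous_of_modulus {d m p : ℕ} {S : Set (EuclideanSpace ℝ (Fin d))}
    {A : Set (EuclideanSpace ℝ (Fin m))} {r : S → A → S → ℝ} {L : ℝ} (hL : 0 < L)
    {ρ₀ ρA : ℝ≥0∞ → ℝ≥0∞} (hρ₀_lim : Tendsto ρ₀ (𝓝 0) (𝓝 0)) (hρA_lim : Tendsto ρA (𝓝 0) (𝓝 0))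
    (hr_mod : ∀ (x₀ x₀' x₁ : S) (a a' : A),
      ENNReal.ofReal |r x₀ a x₁ - r x₀' a' x₁|
        ≤ ENNReal.ofReal (L * (1 + ‖(x₁ : EuclideanSpace ℝ (Fin d))‖ ^ p))
          * (ρ₀ (ENNReal.ofReal
                ‖(x₀ : EuclideanSpace ℝ (Fin d)) - (x₀' : EuclideanSpace ℝ (Fin d))‖)
            + ρA (ENNReal.ofReal
                ‖(a : EuclideanSpace ℝ (Fin m)) - (a' : EuclideanSpace ℝ (Fin m))‖)))
    (z : S × A) (ε : ℝ) (hε : 0 < ε) :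
    ∀ᶠ z' in 𝓝 z, ∀ y, |r z'.1 z'.2 y - r z.1 z.2 y| ≤ ε * weight p y := by
  have h0 : Tendsto (fun z' : S × A => ENNReal.ofReal
      ‖(z'.1 : EuclideanSpace ℝ (Fin d)) - (z.1 : EuclideanSpace ℝ (Fin d))‖) (𝓝 z) (𝓝 0) := by
    have : Continuous fun z' : S × A => ENNReal.ofReal
      ‖(z'.1 : EuclideanSpace ℝ (Fin d)) - (z.1 : EuclideanSpace ℝ (Fin d))‖ :=
      ENNReal.continuous_ofReal.comp (by fun_prop)
    simpa using this.tendsto z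
  have hA : Tendsto (fun z' : S × A => ENNReal.ofReal
      ‖(z'.2 : EuclideanSpace ℝ (Fin m)) - (z.2 : EuclideanSpace ℝ (Fin m))‖) (𝓝 z) (𝓝 0) := by
    have : Continuous fun z' : S × A => ENNReal.ofReal
      ‖(z'.2 : EuclideanSpace ℝ (Fin m)) - (z.2 : EuclideanSpace ℝ (Fin m))‖ :=
      ENNReal.continuous_ofReal.comp (by fun_prop)
    simpa using this.tendsto z
  have hlim := ENNReal.Tendsto.const_mul (a := ENNReal.ofReal L)
    ((hρ₀_lim.comp h0).add (hρA_lim.comp hA)) (Or.inr ENNReal.ofReal_ne_top)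
  rw [add_zero, mul_zero] at hlim
  filter_upwards [hlim.eventually_lt_const (ENNReal.ofReal_pos.2 hε)] with z' hz' y
  refine (ENNReal.ofReal_le_ofReal_iff (mul_nonneg hε.le (weight_pos y).le)).1 ?_
  refine (hr_mod z'.1 z.1 y z'.2 z.2).trans ?_
  rw [ENNReal.ofReal_mul hL.le, ENNReal.ofReal_mul hε.le, mul_right_comm]
  exact mul_le_mul_left hz'.le _

end RobustMDP

open RobustMDP in
theorem theorem2p5 {d m : ℕ}
    -- closed state space, compact nonempty set of actions
    (S : Set (EuclideanSpace ℝ (Fin d))) (hS : IsClosed S)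
    (A : Set (EuclideanSpace ℝ (Fin m))) (hA : IsCompact A) (hA_ne : A.Nonempty)
    (p : ℕ) (hp : p = 0 ∨ p = 1)
    -- assumptions on the set of transition probabilities
    (Amb : S × A → Set (RobustMDP.MomentMeasure p S))
    (hAmb_ne : ∀ z, (Amb z).Nonempty) (hAmb_cpt : ∀ z, IsCompact (Amb z))
    (hAmb_upper : UpperHemicontinuous Amb) (hAmb_lower : LowerHemicontinuous Amb)
    (C_P : ℝ) (hC_P : 1 ≤ C_P)
    (hAmb_growth : ∀ (x : S) (a : A), ∀ μ ∈ Amb (x, a),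
      ∫ y, (1 + ‖(y : EuclideanSpace ℝ (Fin d))‖ ^ p) ∂μ.toMeasure
        ≤ C_P * (1 + ‖(x : EuclideanSpace ℝ (Fin d))‖ ^ p))
    -- assumptions on the reward function
    (r : S → A → S → ℝ)
    (hr_cont : Continuous fun z : S × A × S => r z.1 z.2.1 z.2.2)
    (L : ℝ) (hL : 0 < L) (ρ₀ ρA : ℝ≥0∞ → ℝ≥0∞)
    (hρ₀_zero : ρ₀ 0 = 0) (hρ₀_lim : Tendsto ρ₀ (𝓝 0) (𝓝 0))
    (hρA_zero : ρA 0 = 0) (hρA_lim : Tendsto ρA (𝓝 0) (𝓝 0))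
    (hr_mod : ∀ (x₀ x₀' x₁ : S) (a a' : A),
      ENNReal.ofReal |r x₀ a x₁ - r x₀' a' x₁|
        ≤ ENNReal.ofReal (L * (1 + ‖(x₁ : EuclideanSpace ℝ (Fin d))‖ ^ p))
          * (ρ₀ (ENNReal.ofReal
                ‖(x₀ : EuclideanSpace ℝ (Fin d)) - (x₀' : EuclideanSpace ℝ (Fin d))‖)
            + ρA (ENNReal.ofReal
                ‖(a : EuclideanSpace ℝ (Fin m)) - (a' : EuclideanSpace ℝ (Fin m))‖)))
    (C_r : ℝ) (hC_r : 1 ≤ C_r)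
    (hr_growth : ∀ (x₀ x₁ : S) (a : A),
      |r x₀ a x₁| ≤ C_r * (1 + ‖(x₀ : EuclideanSpace ℝ (Fin d))‖ ^ p
        + ‖(x₁ : EuclideanSpace ℝ (Fin d))‖ ^ p))
    -- the discount factor
    (α : ℝ) (hα_pos : 0 < α) (hα_lt : α < 1 / C_P) :
    -- all expectations, infima and suprema below are well defined and finite
    ((∀ v : S → ℝ, RobustMDP.MemCp p v → ∀ x : S,
        (∀ a : A,
          (∀ μ ∈ Amb (x, a), Integrable (fun y => r x a y + α * v y) μ.toMeasure) ∧
          BddBelow (Set.range fun μ : Amb (x, a) => RobustMDP.oneStep r α v x a μ.1)) ∧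
        BddAbove (Set.range fun a : A => RobustMDP.worstStep Amb r α v x a)) ∧
      (∀ x : S,
        (∀ a : RobustMDP.Policy S A,
          (RobustMDP.admissible Amb x a).Nonempty ∧
          (∀ μ ∈ RobustMDP.admissible Amb x a,
            (∀ᵐ ω ∂μ, Summable fun t : ℕ => α ^ t * r (ω t) ((a t).1 (ω t)) (ω (t + 1))) ∧
            Integrable (RobustMDP.totalReward r α a) μ) ∧
          BddBelow (Set.range fun μ : RobustMDP.admissible Amb x a =>
            ∫ ω, RobustMDP.totalReward r α a ω ∂(μ : Measure (ℕ → S)))) ∧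
        BddAbove (Set.range fun a : RobustMDP.Policy S A => RobustMDP.worstCase Amb r α x a))) ∧
    -- (i)
    (∀ v : S → ℝ, RobustMDP.MemCp p v →
      (∃ P₀ : S × A → RobustMDP.MomentMeasure p S, RobustMDP.IsWorstKernel Amb r α v P₀) ∧
      (∃ a : RobustMDP.LocAction S A, RobustMDP.IsOptimalAction Amb r α v a) ∧
      (∀ (P₀ : S × A → RobustMDP.MomentMeasure p S) (hP₀ : RobustMDP.IsWorstKernel Amb r α v P₀)
        (a : RobustMDP.LocAction S A), RobustMDP.IsOptimalAction Amb r α v a →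
        RobustMDP.locKernel P₀ hP₀.1 a ∈ RobustMDP.locKernels Amb a ∧
        ∀ x : S,
          RobustMDP.bellman Amb r α v x
            = (⨆ b : RobustMDP.LocAction S A, ⨅ κ : RobustMDP.locKernels Amb b,
                RobustMDP.oneStep r α v x (b.1 x) (κ.1.1 x)) ∧
          RobustMDP.bellman Amb r α v x
            = (⨅ κ : RobustMDP.locKernels Amb a,
                RobustMDP.oneStep r α v x (a.1 x) (κ.1.1 x)) ∧
          RobustMDP.bellman Amb r α v x
            = RobustMDP.oneStep r α v x (a.1 x) ((RobustMDP.locKernel P₀ hP₀.1 a).1 x))) ∧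
    -- (ii)
    ((∀ v : S → ℝ, RobustMDP.MemCp p v → RobustMDP.MemCp p (RobustMDP.bellman Amb r α v)) ∧
      (∀ v w : S → ℝ, RobustMDP.MemCp p v → RobustMDP.MemCp p w →
        RobustMDP.cpNorm p (RobustMDP.bellman Amb r α v - RobustMDP.bellman Amb r α w)
          ≤ α * C_P * RobustMDP.cpNorm p (v - w)) ∧
      (∃! v : S → ℝ, RobustMDP.MemCp p v ∧ RobustMDP.bellman Amb r α v = v) ∧
      (∀ v : S → ℝ, RobustMDP.MemCp p v → RobustMDP.bellman Amb r α v = v →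
        ∀ v₀ : S → ℝ, RobustMDP.MemCp p v₀ →
          Tendsto (fun n : ℕ => RobustMDP.cpNorm p ((RobustMDP.bellman Amb r α)^[n] v₀ - v))
            atTop (𝓝 0))) ∧
    -- (iii)
    (∀ v : S → ℝ, RobustMDP.MemCp p v → RobustMDP.bellman Amb r α v = v →
      ∀ (P₀ : S × A → RobustMDP.MomentMeasure p S) (hP₀ : RobustMDP.IsWorstKernel Amb r α v P₀)
        (a : RobustMDP.LocAction S A), RobustMDP.IsOptimalAction Amb r α v a →
        ∀ x : S,
          RobustMDP.pathMeasure x (fun _ => RobustMDP.locKernel P₀ hP₀.1 a)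
              ∈ RobustMDP.admissible Amb x (fun _ => a) ∧
          ∫ ω, RobustMDP.totalReward r α (fun _ => a) ω
              ∂(RobustMDP.pathMeasure x (fun _ => RobustMDP.locKernel P₀ hP₀.1 a))
            = RobustMDP.worstCase Amb r α x (fun _ => a) ∧
          RobustMDP.worstCase Amb r α x (fun _ => a) = RobustMDP.value Amb r α x ∧
          RobustMDP.value Amb r α x = v x) := by
  have : CompactSpace A := isCompact_iff_compactSpace.1 hA
  have : Nonempty A := hA_ne.to_subtype
  have hC_P0 : 0 < C_P := zero_lt_one.trans_le hC_P
  have H : Assumptions Amb r α C_P C_r :=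
    { nonempty := hAmb_ne
      isCompact := hAmb_cpt
      upper := hAmb_upper
      lower := hAmb_lower
      one_le_C_P := hC_P
      growth := hAmb_growth
      continuous_reward := hr_cont
      reward_equicontinuous := reward_equicontinuous_of_modulus hL hρ₀_lim hρA_lim hr_mod
      one_le_C_r := hC_r
      reward_growth := fun x a y => (hr_growth x y a).trans
        (mul_le_mul_of_nonneg_left (by unfold weight; linarith) (zero_le_one.trans hC_r))
      α_pos := hα_pos
      α_mul_lt_one := (lt_div_iff₀ hC_P0).1 hα_lt }
  have hopt : ∀ v : S → ℝ, MemCp p v → ∀ a : LocAction S A, IsOptimalAction Amb r α v a →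
      ∀ x, worstStep Amb r α v x (a.1 x) = bellman Amb r α v x := fun v hv a ha x => by
    rw [ha x, H.iSup_locAction_worstStep hv x]
  refine ⟨⟨fun v hv x => ⟨fun a => ⟨fun μ _ => μ.integrable (H.memCp_integrand hv x a),
      H.bddBelow_oneStep hv x a⟩, H.bddAbove_worstStep hv x⟩,
    fun x => ⟨fun a => ⟨H.admissible_nonempty x a, ?_, H.bddBelow_integral_totalReward x a⟩,
      H.bddAbove_worstCase x⟩⟩, ?_, ⟨fun v hv => H.memCp_bellman hv,
    fun v w hv hw => H.cpNorm_bellman_sub_le hv hw, ?_,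
    fun v hv hTv v₀ hv₀ => H.tendsto_iterate_bellman hv hTv hv₀⟩, ?_⟩
  · rintro _ ⟨κ, hκ, rfl⟩
    exact H.ae_summable_and_integrable_totalReward hκ x
  · intro v hv
    refine ⟨H.exists_isWorstKernel hv, ?_, fun P₀ hP₀ a ha => ⟨hP₀.locKernel_mem a, fun x => ?_⟩⟩
    · obtain ⟨a, ha⟩ := H.exists_locAction_eq_bellman hv
      exact ⟨a, fun x => by rw [ha x, H.iSup_locAction_worstStep hv x]⟩
    · have hax := hopt v hv a ha x
      refine ⟨?_, ?_, ?_⟩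
      · simp_rw [fun b : LocAction S A => H.iInf_locKernels_oneStep hv b x]
        exact (H.iSup_locAction_worstStep hv x).symm
      · rw [H.iInf_locKernels_oneStep hv a x, hax]
      · exact hax.symm.trans (hP₀.2 x (a.1 x)).2.symm
  · obtain ⟨v, hv, hTv⟩ := H.exists_bellman_eq
    exact ⟨v, ⟨hv, hTv⟩, fun w hw => H.bellman_fixedPoint_unique hw.1 hv hw.2 hTv⟩
  · intro v hv hTv P₀ hP₀ a ha x
    have hax := hopt v hv a ha
    have hw := H.worstCase_eq_fixedPoint hv hTv hP₀ hax x
    have hV := H.value_eq_fixedPoint hv hTv hP₀ hax x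
    exact ⟨hP₀.pathMeasure_mem x fun _ => a,
      (H.integral_totalReward_eq_fixedPoint hv hTv hP₀ hax x).trans hw.symm, hw.trans hV.symm, hV⟩
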